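/- Let $\mathcal T=(\mathcal V,\mathcal E)$ be a finite tree, let $\lambda>0$, and let $\boldsymbol\alpha=(\alpha_e)_{e\in\mathcal E}$ with $\alpha_e\in(0,1)$ for every edge $e$. For a root $r\in\mathcal V$, write $\mathcal T_r$ for the tree rooted at $r$; a vertex $u\neq v$ is a descendant of $v$ if $v$ lies on the path from $u$ to $r$, the set $\mathrm{ch}(v)$ of children of $v$ consists of its descendants adjacent to it, and $\mathrm{pa}(j)$ denotes the parent of $j\neq r$. We write $\boldsymbol N=(N_v)_{v\in\mathcal V}\sim\mathrm{MPMRF}(\lambda,\boldsymbol\alpha,\mathcal T)$ if, for some choice of the root $r$, the random vector $\boldsymbol N$ has the distribution of the vector of count variables defined recursively along $\mathcal T_r$ by $$N_r=L_r,\qquad N_j=L_j+\sum_{i=1}^{N_{\mathrm{pa}(j)}} I_{j,i}\quad (j\neq r),$$ where all the variables $L_v$, $I_{j,i}$ are independent, $L_r\sim\mathrm{Poisson}(\lambda)$, $L_j\sim\mathrm{Poisson}(\lambda(1-\alpha_{(\mathrm{pa}(j),j)}))$ and $I_{j,i}\sim\mathrm{Bernoulli}(\alpha_{(\mathrm{pa}(j),j)})$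 for $j\ne r$, $i\ge1$. Let $M=\sum_{v\in\mathcal V}N_v$. For a root $r$ and $\boldsymbol t\in[-1,1]^{\mathcal V}$, define recursively $$\eta_v^{\mathcal T_r}(\boldsymbol t)=t_v\prod_{j\in\mathrm{ch}(v)}\bigl(1-\alpha_{(v,j)}+\alpha_{(v,j)}\,\eta_j^{\mathcal T_r}(\boldsymbol t)\bigr),$$ children being taken in $\mathcal T_r$ (an empty product is $1$). For $v\in\mathcal V$, let $H_v^{\mathcal T_v}$ be a random variable with values in $\mathbb N=\{0,1,2,\dots\}$ whose probability generating function is $\mathrm E[t^{H_v^{\mathcal T_v}}]=\eta_v^{\mathcal T_v}(t,\dots,t)$, $t\in[-1,1]$. **Theorem.** Let $\boldsymbol N\sim\mathrm{MPMRF}(\lambda,\boldsymbol\alpha,\mathcal T)$ and $v,w\in\mathcal V$. If $H_v^{\mathcal T_v}\preceq_{st}H_w^{\mathcal T_w}$ in the usual stochastic order, that is, $\mathrm P(H_v^{\mathcal T_v}>x)\le \mathrm P(H_w^{\mathcal T_w}>x)$ for all $x\in\mathbb R$, then $$(N_v,M)\preceq_{sm}(N_w,M)$$ in the supermodular order: $\mathrm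 E[\zeta(N_v,M)]\le\mathrm E[\zeta(N_w,M)]$ for every function $\zeta:\mathbb R^2\to\mathbb R$ such that $\zeta(\boldsymbol x)+\zeta(\boldsymbol y)\le\zeta(\boldsymbol x\wedge\boldsymbol y)+\zeta(\boldsymbol x\vee\boldsymbol y)$ for all $\boldsymbol x,\boldsymbol y\in\mathbb R^2$ (componentwise minimum and maximum) and for which both expectations exist (are finite). In other words, $N_v$ is less contributing than $N_w$ to $M$. -/

import Mathlib

open MeasureTheory ProbabilityTheory

/-! ### Filial relations in a rooted tree -/

section RootedTree

variable {V : Type*}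

/-- Descendants of `v` when the tree `T` is rooted at `r`: the vertices `u ≠ v` such that
`v` is on the path from `u` to the root. -/
def dsc (T : SimpleGraph V) (r v : V) : Set V :=
  {u | u ≠ v ∧ ∃ p : T.Walk u r, p.IsPath ∧ v ∈ p.support}

/-- Children of `v` when the tree `T` is rooted at `r`: its descendants that are adjacent to it. -/
def ch (T : SimpleGraph V) (r v : V) : Set V :=
  {j | j ∈ dsc T r v ∧ T.Adj v j}

/-- In a tree, a child is farther from the root than its parent. -/
theorem dist_lt_of_mem_ch {T : SimpleGraph V} (hT : T.IsTree) {r v j : V}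
    (hj : j ∈ ch T r v) : T.dist v r < T.dist j r := by
  classical
  obtain ⟨⟨hne, p, hp, hv⟩, -⟩ := hj
  have hdist : T.dist j r = p.length := by
    obtain ⟨q, hq, hlen⟩ := (hT.1 j r).exists_path_of_dist
    rw [← hlen, (hT.existsUnique_path j r).unique hq hp]
  rw [hdist]
  exact lt_of_le_of_lt (SimpleGraph.dist_le _)
    (SimpleGraph.Walk.length_dropUntil_lt_length hv hne.symm)

open Classical in
/-- The functions `η_v^{T_r}` attached to the tree `T` rooted at `r` with edge parameters `α`,
defined by the recursion
`η_v(t) = t_v * ∏_{j ∈ ch(v)} (1 - α_{(v,j)} + α_{(v,j)} * η_j(t))`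
(the value only depends on the `t_j` with `j = v` or `j` a descendant of `v`). -/
noncomputable def eta [Fintype V] (T : SimpleGraph V) (hT : T.IsTree) (α : Sym2 V → unitInterval)
    (r : V) (t : V → ℝ) (v : V) : ℝ :=
  t v * ∏ j : {j // j ∈ ch T r v},
    (1 - (α s(v, j.1) : ℝ) + (α s(v, j.1) : ℝ) * eta T hT α r t j.1)
termination_by Finset.univ.sup (fun u => T.dist u r) - T.dist v r
decreasing_by
  have h1 := dist_lt_of_mem_ch hT j.2
  have h2 := Finset.le_sup (f := fun u => T.dist u r) (Finset.mem_univ j.1)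
  omega

end RootedTree

/-! ### The tree-structured Poisson Markov random field -/

section MPMRF

variable {V : Type*} {Ω : Type*}

/-- Binomial thinning `α ∘ N = ∑_{i=1}^{N} I_i`, where `I` is the sequence of
Bernoulli variables used for the thinning. -/
def thinning (I : ℕ → Ω → ℕ) (N : Ω → ℕ) (ω : Ω) : ℕ :=
  ∑ i ∈ Finset.range (N ω), I i ω

/-- The stochastic representation rooted at `r`: the `L_v` are Poisson variables of parameter
`lam * (1 - α_{(pa(v),v)})` (parameter `lam` at the root), the `I_{v,i}` are Bernoulli variables
of parameter `α_{(pa(v),v)}`, all of these are independent, and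
`N_r = L_r`, `N_v = L_v + α_{(pa(v),v)} ∘ N_{pa(v)}` for `v ≠ r`. Every vertex `j ≠ r` of a tree
is a child of exactly one vertex, its parent. -/
structure IsPoissonDynamics [MeasurableSpace Ω] (P : Measure Ω) (lam : ℝ)
    (α : Sym2 V → unitInterval) (T : SimpleGraph V) (r : V)
    (L : V → Ω → ℕ) (I : V → ℕ → Ω → ℕ) (N : V → Ω → ℕ) : Prop where
  hasLaw_root : HasLaw (L r) (poissonMeasure lam.toNNReal) P
  hasLaw_child : ∀ v, ∀ j ∈ ch T r v,
    HasLaw (L j) (poissonMeasure (lam * (1 - (α s(v, j) : ℝ))).toNNReal) P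
  hasLaw_thinning : ∀ v, ∀ j ∈ ch T r v, ∀ i : ℕ,
    HasLaw (I j i) (bernoulliMeasure 1 0 (α s(v, j))) P
  indep : iIndepFun (Sum.elim L (fun p : V × ℕ => I p.1 p.2)) P
  eq_root : ∀ ω, N r ω = L r ω
  eq_child : ∀ v, ∀ j ∈ ch T r v, ∀ ω, N j ω = L j ω + thinning (I j) (N v) ω

/-- `N ~ MPMRF(lam, α, T)`: the random vector `N` has the distribution of a vector given by the
stochastic representation, for some choice of the root. -/
def IsMPMRF [MeasurableSpace Ω] (P : Measure Ω) (lam : ℝ) (α : Sym2 V → unitInterval)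
    (T : SimpleGraph V) (N : V → Ω → ℕ) : Prop :=
  ∃ (r : V) (Ω' : Type) (_ : MeasurableSpace Ω') (P' : Measure Ω')
    (L : V → Ω' → ℕ) (I : V → ℕ → Ω' → ℕ) (N' : V → Ω' → ℕ),
    IsProbabilityMeasure P' ∧ IsPoissonDynamics P' lam α T r L I N' ∧
      IdentDistrib (fun ω v => N v ω) (fun ω v => N' v ω) P P'

end MPMRF

/-! ### Probability generating functions and stochastic orders -/

section Orders

variable {Ω Ω' : Type*} [MeasurableSpace Ω] [MeasurableSpace Ω']

/-- The count random variable `H` has probability generating function `φ` on `[-1, 1]`. -/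
def HasPgf (P : Measure Ω) (H : Ω → ℕ) (φ : ℝ → ℝ) : Prop :=
  AEMeasurable H P ∧ ∀ t ∈ Set.Icc (-1 : ℝ) 1, ∫ ω, t ^ (H ω) ∂P = φ t

/-- The usual stochastic order `X ≤_st Y`. -/
def StochasticLE (P : Measure Ω) (X : Ω → ℝ) (P' : Measure Ω') (Y : Ω' → ℝ) : Prop :=
  ∀ x : ℝ, P {ω | x < X ω} ≤ P' {ω | x < Y ω}

/-- Supermodular functions on `ℝ^ι`, for the componentwise minimum and maximum. -/
def IsSupermodular {ι : Type*} (ζ : (ι → ℝ) → ℝ) : Prop :=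
  ∀ x y : ι → ℝ, ζ x + ζ y ≤ ζ (x ⊓ y) + ζ (x ⊔ y)

/-- The supermodular order `X ≤_sm Y` of random vectors: `E[ζ(X)] ≤ E[ζ(Y)]` for every
supermodular `ζ` for which both expectations exist. -/
def SupermodularLE {ι : Type*} (P : Measure Ω) (X : Ω → ι → ℝ)
    (P' : Measure Ω') (Y : Ω' → ι → ℝ) : Prop :=
  ∀ ζ : (ι → ℝ) → ℝ, IsSupermodular ζ →
    Integrable (fun ω => ζ (X ω)) P → Integrable (fun ω => ζ (Y ω)) P' →
      ∫ ω, ζ (X ω) ∂P ≤ ∫ ω, ζ (Y ω) ∂P'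

end Orders

/-!
The field is a Poisson family of clusters. With the tree rooted at `r`, an individual born at a vertex `j` through
the innovation `L j` spreads over a connected set of descendants of `j`, and the number of vertices
reached has generating function `eta j`. So the joint generating function of the field is
`exp (lam * logPgf r)`, where `logPgf r` adds up the contributions of the innovations
(`IsPoissonDynamics.integral_prod_pow`), and `logPgf r` does not depend on the root (`logPgf_eq`).
With the root at `v`, exactly the clusters born at `v` contain `v`: they are counted by `N v`, their
sizes have the law of `H_v`, and the total size of all clusters is `M`. Hence `(N v, M)` has the
generating function `exp (lam * ((s - 1) * p_v(t) + Λ(t) - Λ(1)))`, with `p_v` the generating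
function of `H_v`, and with a polynomial `Λ ≥ p_v, p_w` which is the same for `v` and `w`: the two
vectors arise from two markings of a single family of clusters.

To compare the markings, let `c = min(p_v, p_w)` coefficientwise, `a = p_v - c` and `b = p_w - c`.
As `a + b + c ≤ Λ`, the family splits into independent Poisson families of clusters of classes
`c`, `a`, `b` and a remaining class `d`. The first marking counts `c` and `a`, the second one `c` and
`b`, and `a` is stochastically smaller than `b` with the same mass. If `k` and `l` are the numbers
of clusters of the classes `a` and `b`, then `(k, l)` and `(l, k)` have the same weight, and
supermodularity gives the inequality for the sum of these two terms (`markedLaw_supermodular`).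
Summing it over `k` and `l` only uses the integrability for the two given vectors, which an
interpolation between the two markings by intermediate ones would not provide.

Laws are identified by their generating functions (`measure_ext_of_pgf`), and finitely supported
measures on `ℕ` are handled as polynomials with nonnegative coefficients.
-/

/-! ### Probability generating functions -/

section Pgf

open BoundedContinuousFunction

/-- Finite measures on `ι → ℕ` are determined by their joint probability generating function on
the unit cube: the monomials `x ↦ ∏ i, u i ^ x i` span a point-separating subalgebra of the bounded
functions. -/
theorem measure_ext_of_pgf {ι : Type*} [Fintype ι] {μ ν : Measure (ι → ℕ)}
    [IsFiniteMeasure μ] [IsFiniteMeasure ν]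
    (h : ∀ u : ι → ℝ, (∀ i, u i ∈ Set.Icc (0 : ℝ) 1) →
      ∫ x, ∏ i, u i ^ x i ∂μ = ∫ x, ∏ i, u i ^ x i ∂ν) : μ = ν := by
  classical
  have hbd : ∀ u : ι → Set.Icc (0 : ℝ) 1, ∀ x : ι → ℕ, ‖∏ i, (u i : ℝ) ^ x i‖ ≤ 1 := by
    intro u x
    rw [Real.norm_eq_abs, abs_of_nonneg (Finset.prod_nonneg fun i _ => pow_nonneg (u i).2.1 _)]
    exact Finset.prod_le_one (fun i _ => pow_nonneg (u i).2.1 _)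
      fun i _ => pow_le_one₀ (u i).2.1 (u i).2.2
  have hcont : ∀ u : ι → Set.Icc (0 : ℝ) 1,
      Continuous fun x : ι → ℕ => ∏ i, (u i : ℝ) ^ x i := by
    intro u
    refine continuous_finsetProd _ fun i _ => ?_
    exact (continuous_of_discreteTopology (f := fun n : ℕ => (u i : ℝ) ^ n)).comp
      (continuous_apply i)
  let m : (ι → Set.Icc (0 : ℝ) 1) → ((ι → ℕ) →ᵇ ℝ) := fun u =>
    BoundedContinuousFunction.ofNormedAddCommGroup _ (hcont u) 1 (hbd u)
  have hm : ∀ u x, m u x = ∏ i, (u i : ℝ) ^ x i := fun u x => rfl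
  -- The monomials are closed under multiplication, so the algebra they generate is their span.
  have hsp : ∀ f ∈ Algebra.adjoin ℝ (Set.range m), f ∈ Submodule.span ℝ (Set.range m) := by
    intro f hf
    rw [← Subalgebra.mem_toSubmodule, Algebra.adjoin_eq_span] at hf
    have hcl : (Submonoid.closure (Set.range m) : Set ((ι → ℕ) →ᵇ ℝ)) = Set.range m := by
      refine le_antisymm ?_ Submonoid.subset_closure
      intro g hg
      induction hg using Submonoid.closure_induction with
      | mem x hx => exact hx
      | one => exact ⟨fun _ => 1, by ext x; simp [hm]⟩
      | mul x y _ _ hx hy =>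
        obtain ⟨u, rfl⟩ := hx
        obtain ⟨v, rfl⟩ := hy
        exact ⟨fun i => u i * v i, by ext x; simp [hm, mul_pow, Finset.prod_mul_distrib]⟩
    rwa [hcl] at hf
  let A : StarSubalgebra ℝ ((ι → ℕ) →ᵇ ℝ) :=
    { Algebra.adjoin ℝ (Set.range m) with
      star_mem' := by
        intro f hf
        have : star f = f := by ext x; simp
        rw [this]; exact hf }
  refine ext_of_forall_mem_subalgebra_integral_eq_of_polish (𝕜 := ℝ) (A := A) ?_ ?_
  · intro x y hxy
    obtain ⟨i, hi⟩ := Function.ne_iff.1 hxy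
    let u : ι → Set.Icc (0 : ℝ) 1 := fun j => if j = i then ⟨1 / 2, by norm_num⟩ else 1
    refine ⟨_, ⟨m u, ⟨m u, Algebra.subset_adjoin ⟨u, rfl⟩, rfl⟩, rfl⟩, ?_⟩
    have hu : ∀ z : ι → ℕ, m u z = (1 / 2 : ℝ) ^ z i := by
      intro z
      rw [hm, Finset.prod_eq_single i]
      · simp [u]
      · intro j _ hj; simp [u, hj]
      · simp
    change m u x ≠ m u y
    rw [hu, hu]
    exact fun e => hi (pow_right_injective₀ (by norm_num) (by norm_num) e)
  · intro g hg
    have hg' := hsp g hg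
    induction hg' using Submodule.span_induction with
    | mem x hx =>
      obtain ⟨u, rfl⟩ := hx
      exact h _ fun i => (u i).2
    | zero => simp
    | add x y hx hy ihx ihy =>
      have ex := ihx (Algebra.span_le_adjoin ℝ _ hx)
      have ey := ihy (Algebra.span_le_adjoin ℝ _ hy)
      simp only [BoundedContinuousFunction.add_apply]
      rw [integral_add (x.integrable _) (y.integrable _),
        integral_add (x.integrable _) (y.integrable _), ex, ey]
    | smul c x hx ihx =>
      have ex := ihx (Algebra.span_le_adjoin ℝ _ hx)
      simp only [BoundedContinuousFunction.smul_apply]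
      rw [integral_smul, integral_smul, ex]

/-- The probability generating function of a Poisson variable. -/
theorem integral_pow_poissonMeasure (r : NNReal) {u : ℝ} :
    ∫ n, u ^ n ∂(poissonMeasure r) = Real.exp (r * (u - 1)) := by
  rw [integral_poissonMeasure]
  have h := (NormedSpace.expSeries_div_hasSum_exp ((r : ℝ) * u)).mul_left (Real.exp (-r))
  rw [← Real.exp_eq_exp_ℝ, ← Real.exp_add] at h
  convert! h.tsum_eq using 1
  · congr 1; ext n; simp only [smul_eq_mul, mul_pow]; ring
  · congr 1; ring

end Pgf

/-! ### Stochastic order of polynomials -/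

section Polynomials

open Polynomial

/-- The linear pairing `∑ k, p_k f(k)` of a polynomial with a function on `ℕ`: the integral of `f`
against the measure on `ℕ` whose generating function is `p`. -/
noncomputable def pairing (f : ℕ → ℝ) : ℝ[X] →ₗ[ℝ] ℝ :=
  Polynomial.lsum fun k => f k • LinearMap.id

theorem pairing_eq_sum (f : ℕ → ℝ) (p : ℝ[X]) :
    pairing f p = ∑ k ∈ p.support, p.coeff k * f k := by
  simp [pairing, Polynomial.lsum_apply, Polynomial.sum_def, mul_comm]

theorem hasSum_pairing (f : ℕ → ℝ) (p : ℝ[X]) :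
    HasSum (fun k => p.coeff k * f k) (pairing f p) := by
  rw [pairing_eq_sum]
  refine hasSum_sum_of_ne_finset_zero fun k hk => ?_
  rw [Polynomial.notMem_support_iff.1 hk, zero_mul]

theorem pairing_pow (t : ℝ) (p : ℝ[X]) : pairing (fun k => t ^ k) p = p.eval t := by
  rw [pairing_eq_sum, Polynomial.eval_eq_sum, Polynomial.sum_def]

theorem pairing_sub_fun (f g : ℕ → ℝ) (p : ℝ[X]) :
    pairing (fun k => f k - g k) p = pairing f p - pairing g p := by
  simp only [pairing_eq_sum, mul_sub, Finset.sum_sub_distrib]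

theorem pairing_mul (f : ℕ → ℝ) (p q : ℝ[X]) :
    pairing f (p * q) = pairing (fun i => pairing (fun j => f (i + j)) q) p := by
  have hmon : ∀ (i : ℕ) (c : ℝ) (j : ℕ) (c' : ℝ),
      pairing f (monomial i c * monomial j c') = c' * (c * f (i + j)) := by
    intro i c j c'
    rw [monomial_mul_monomial]
    simp [pairing, mul_comm, mul_left_comm]
  have hmon' : ∀ (g : ℕ → ℝ) (j : ℕ) (c : ℝ), pairing g (monomial j c) = c * g j := by
    intro g j c
    simp [pairing, mul_comm]
  induction p using Polynomial.induction_on' with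
  | add p p' hp hp' => rw [add_mul, map_add, map_add, hp, hp']
  | monomial i c =>
    rw [hmon']
    induction q using Polynomial.induction_on' with
    | add q q' hq hq' => rw [mul_add, map_add, map_add, hq, hq', mul_add]
    | monomial j c' => rw [hmon, hmon', mul_left_comm]

/-- Polynomials with nonnegative coefficients: generating functions of finitely supported
measures on `ℕ`. -/
def CoeffNonneg (p : ℝ[X]) : Prop := ∀ k, 0 ≤ p.coeff k

theorem CoeffNonneg.add {p q : ℝ[X]} (hp : CoeffNonneg p) (hq : CoeffNonneg q) :
    CoeffNonneg (p + q) := fun k => by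
  rw [coeff_add]; exact add_nonneg (hp k) (hq k)

theorem CoeffNonneg.mul {p q : ℝ[X]} (hp : CoeffNonneg p) (hq : CoeffNonneg q) :
    CoeffNonneg (p * q) := fun k => by
  rw [coeff_mul]; exact Finset.sum_nonneg fun x _ => mul_nonneg (hp _) (hq _)

theorem CoeffNonneg.C {c : ℝ} (hc : 0 ≤ c) : CoeffNonneg (C c) := fun k => by
  rw [coeff_C]; split_ifs <;> simp [hc]

theorem CoeffNonneg.X : CoeffNonneg X := fun k => by
  rw [coeff_X]; split_ifs <;> simp

theorem CoeffNonneg.prod {ι : Type*} (s : Finset ι) {p : ι → ℝ[X]}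
    (h : ∀ i ∈ s, CoeffNonneg (p i)) : CoeffNonneg (∏ i ∈ s, p i) :=
  Finset.prod_induction _ _ (fun _ _ => CoeffNonneg.mul) (CoeffNonneg.C zero_le_one) h

theorem CoeffNonneg.sum {ι : Type*} (s : Finset ι) {p : ι → ℝ[X]}
    (h : ∀ i ∈ s, CoeffNonneg (p i)) : CoeffNonneg (∑ i ∈ s, p i) :=
  Finset.sum_induction _ _ (fun _ _ => CoeffNonneg.add) (fun k => by simp) h

theorem CoeffNonneg.pow {p : ℝ[X]} (hp : CoeffNonneg p) (n : ℕ) : CoeffNonneg (p ^ n) := by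
  simpa using CoeffNonneg.prod (Finset.range n) (p := fun _ => p) fun _ _ => hp

theorem CoeffNonneg.eval {p : ℝ[X]} (hp : CoeffNonneg p) {t : ℝ} (ht : 0 ≤ t) :
    0 ≤ p.eval t := by
  rw [← pairing_pow, pairing_eq_sum]
  exact Finset.sum_nonneg fun k _ => mul_nonneg (hp k) (pow_nonneg ht k)

theorem CoeffNonneg.pairing_mono {p : ℝ[X]} (hp : CoeffNonneg p) {f g : ℕ → ℝ}
    (h : ∀ k, f k ≤ g k) : pairing f p ≤ pairing g p := by
  rw [pairing_eq_sum, pairing_eq_sum]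
  exact Finset.sum_le_sum fun k _ => mul_le_mul_of_nonneg_left (h k) (hp k)

/-- The usual stochastic order, on generating functions. -/
def StLE (p q : ℝ[X]) : Prop := ∀ f : ℕ → ℝ, Monotone f → pairing f p ≤ pairing f q

theorem StLE.refl (p : ℝ[X]) : StLE p p := fun _ _ => le_rfl

theorem StLE.trans {p q r : ℝ[X]} (h : StLE p q) (h' : StLE q r) : StLE p r :=
  fun f hf => (h f hf).trans (h' f hf)

/-- Convolution with a fixed measure preserves the stochastic order. -/
theorem StLE.mul_left {p q : ℝ[X]} (h : StLE p q) {r : ℝ[X]} (hr : CoeffNonneg r) :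
    StLE (r * p) (r * q) := by
  intro f hf
  rw [pairing_mul, pairing_mul]
  exact hr.pairing_mono fun i => h _ fun j j' hj => hf (by lia)

theorem StLE.pow {p q : ℝ[X]} (h : StLE p q) (hp : CoeffNonneg p) (hq : CoeffNonneg q) (n : ℕ) :
    StLE (p ^ n) (q ^ n) := by
  induction n with
  | zero => simpa using StLE.refl _
  | succ n ih =>
    have h1 := h.mul_left (hp.pow n)
    have h2 := ih.mul_left hq
    rw [mul_comm q, mul_comm q] at h2
    simpa only [pow_succ] using h1.trans h2

/-- If `p` has tails bounded by those of `q` and the same total mass then `p` is stochastically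
smaller (summation by parts). -/
theorem StLE.of_tails {p q : ℝ[X]} (h1 : p.eval 1 = q.eval 1)
    (h : ∀ j : ℕ, pairing (fun k => if j < k then 1 else 0) p ≤
      pairing (fun k => if j < k then 1 else 0) q) : StLE p q := by
  intro f hf
  have key : ∀ (r : ℝ[X]) (n : ℕ), r.natDegree ≤ n → pairing f r =
      f 0 * r.eval 1 + ∑ j ∈ Finset.range n,
        (f (j + 1) - f j) * pairing (fun k => if j < k then 1 else 0) r := by
    intro r n hn
    have hk : ∀ k ∈ r.support, f k =
        f 0 + ∑ j ∈ Finset.range n, (f (j + 1) - f j) * if j < k then 1 else 0 := by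
      intro k hk
      have hkn : k ≤ n := (le_natDegree_of_mem_supp k hk).trans hn
      simp only [mul_ite, mul_one, mul_zero]
      rw [← Finset.sum_filter]
      have : (Finset.range n).filter (fun j => j < k) = Finset.range k := by
        ext j; simp; lia
      rw [this, Finset.sum_range_sub]; ring
    rw [pairing_eq_sum, Finset.sum_congr rfl fun k hks => by rw [hk k hks]]
    simp only [mul_add, Finset.sum_add_distrib, Finset.mul_sum, pairing_eq_sum]
    congr 1
    · rw [eval_eq_sum, sum_def, Finset.mul_sum]
      exact Finset.sum_congr rfl fun k _ => by simp [mul_comm]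
    · rw [Finset.sum_comm]
      exact Finset.sum_congr rfl fun j _ => Finset.sum_congr rfl fun k _ => by ring
  rw [key p _ (le_max_left _ q.natDegree), key q _ (le_max_right p.natDegree _), h1]
  gcongr with j _
  · exact sub_nonneg.2 (hf (Nat.le_succ j))
  · exact h j

end Polynomials

/-! ### Supermodular functions of two variables -/

section Supermodular

/-- Supermodularity says that the increment of `ζ` in the first variable is monotone in the second
one. -/
theorem IsSupermodular.exchange {ζ : (Fin 2 → ℝ) → ℝ} (hζ : IsSupermodular ζ) {k l y z : ℝ}
    (hkl : k ≤ l) (hyz : y ≤ z) :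
    ζ ![k, z] + ζ ![l, y] ≤ ζ ![k, y] + ζ ![l, z] := by
  have h := hζ ![k, z] ![l, y]
  have h1 : (![k, z] : Fin 2 → ℝ) ⊓ ![l, y] = ![k, y] := by
    ext i; fin_cases i <;> simp [hkl, hyz]
  have h2 : (![k, z] : Fin 2 → ℝ) ⊔ ![l, y] = ![l, z] := by
    ext i; fin_cases i <;> simp [hkl, hyz]
  rwa [h1, h2] at h

end Supermodular

/-! ### Marked Poisson clusters -/

section MarkedClusters

open Polynomial Nat

/-- Generating function of the total size of `i.1`, `i.2.1`, `i.2.2.1`, `i.2.2.2` clusters of the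
respective classes `c`, `d`, `a`, `b`. -/
noncomputable def clusterSize (a b c d : ℝ[X]) (i : ℕ × ℕ × ℕ × ℕ) : ℝ[X] :=
  c ^ i.1 * (d ^ i.2.1 * (a ^ i.2.2.1 * b ^ i.2.2.2))

/-- The Poisson weight of the numbers of clusters of each class, up to the normalizing factor. -/
noncomputable def clusterWeight (i : ℕ × ℕ × ℕ × ℕ) : ℝ :=
  ((i.1)! : ℝ)⁻¹ * (((i.2.1)! : ℝ)⁻¹ * (((i.2.2.1)! : ℝ)⁻¹ * ((i.2.2.2)! : ℝ)⁻¹))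

/-- Four independent Poisson families of clusters, whose sizes have intensities with generating
functions `c`, `d`, `a`, `b`; the first coordinate counts the clusters of the classes `c` and `a`
and the second one is the total size of all clusters. The factor `K` normalizes. -/
noncomputable def markedLaw (K : ℝ) (a b c d : ℝ[X]) : Measure (Fin 2 → ℕ) :=
  Measure.sum fun z : (ℕ × ℕ × ℕ × ℕ) × ℕ =>
    ENNReal.ofReal (K * clusterWeight z.1 * (clusterSize a b c d z.1).coeff z.2) •
      Measure.dirac ![z.1.1 + z.1.2.2.1, z.2]

theorem clusterWeight_nonneg (i : ℕ × ℕ × ℕ × ℕ) : 0 ≤ clusterWeight i := by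
  unfold clusterWeight; positivity

theorem clusterSize_nonneg {a b c d : ℝ[X]} (ha : CoeffNonneg a) (hb : CoeffNonneg b)
    (hc : CoeffNonneg c) (hd : CoeffNonneg d) (i : ℕ × ℕ × ℕ × ℕ) :
    CoeffNonneg (clusterSize a b c d i) :=
  (hc.pow _).mul ((hd.pow _).mul ((ha.pow _).mul (hb.pow _)))

theorem hasSum_pow_inv_factorial (x : ℝ) : HasSum (fun n : ℕ => (n ! : ℝ)⁻¹ * x ^ n)
    (Real.exp x) := by
  have h := NormedSpace.expSeries_div_hasSum_exp x
  rw [← Real.exp_eq_exp_ℝ] at h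
  simpa [div_eq_inv_mul] using h

theorem hasSum_mul_of_nonneg {ι κ : Type*} {f : ι → ℝ} {g : κ → ℝ} {x y : ℝ}
    (hf : HasSum f x) (hg : HasSum g y) (hf0 : ∀ i, 0 ≤ f i) (hg0 : ∀ i, 0 ≤ g i) :
    HasSum (fun i : ι × κ => f i.1 * g i.2) (x * y) :=
  hf.mul hg (hf.summable.mul_of_nonneg hg.summable hf0 hg0)

section

variable {K : ℝ} {a b c d : ℝ[X]} (hK : 0 ≤ K) (ha : CoeffNonneg a) (hb : CoeffNonneg b)
  (hc : CoeffNonneg c) (hd : CoeffNonneg d)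
include hK ha hb hc hd

theorem markedLaw_weight_nonneg (z : (ℕ × ℕ × ℕ × ℕ) × ℕ) :
    0 ≤ K * clusterWeight z.1 * (clusterSize a b c d z.1).coeff z.2 :=
  mul_nonneg (mul_nonneg hK (clusterWeight_nonneg _)) (clusterSize_nonneg ha hb hc hd _ _)

theorem markedLaw_hasSum_pgf {s t : ℝ} (hs : 0 ≤ s) (ht : 0 ≤ t) :
    HasSum (fun z : (ℕ × ℕ × ℕ × ℕ) × ℕ =>
      (K * clusterWeight z.1 * (clusterSize a b c d z.1).coeff z.2) *
        (s ^ (z.1.1 + z.1.2.2.1) * t ^ z.2))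
      (K * Real.exp (s * (c + a).eval t + (d + b).eval t)) := by
  have h4 := (hasSum_mul_of_nonneg (hasSum_pow_inv_factorial (s * c.eval t))
    (hasSum_mul_of_nonneg (hasSum_pow_inv_factorial (d.eval t))
      (hasSum_mul_of_nonneg (hasSum_pow_inv_factorial (s * a.eval t))
        (hasSum_pow_inv_factorial (b.eval t)) ?_ ?_) ?_ ?_) ?_ ?_).mul_left K
  · rw [← Real.exp_add, ← Real.exp_add, ← Real.exp_add] at h4
    have hrow : ∀ i : ℕ × ℕ × ℕ × ℕ, HasSum (fun y : ℕ =>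
        (K * clusterWeight i * (clusterSize a b c d i).coeff y) *
          (s ^ (i.1 + i.2.2.1) * t ^ y))
        (K * (((i.1)! : ℝ)⁻¹ * (s * c.eval t) ^ i.1 * (((i.2.1)! : ℝ)⁻¹ * (d.eval t) ^ i.2.1 *
          (((i.2.2.1)! : ℝ)⁻¹ * (s * a.eval t) ^ i.2.2.1 *
            (((i.2.2.2)! : ℝ)⁻¹ * (b.eval t) ^ i.2.2.2))))) := by
      intro i
      convert! (hasSum_pairing (fun k => t ^ k) (clusterSize a b c d i)).mul_left
        (K * clusterWeight i * s ^ (i.1 + i.2.2.1)) using 1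
      · ext y; ring
      · rw [pairing_pow]
        simp only [clusterSize, clusterWeight, eval_mul, eval_pow]
        ring
    have hnn : 0 ≤ fun z : (ℕ × ℕ × ℕ × ℕ) × ℕ =>
        (K * clusterWeight z.1 * (clusterSize a b c d z.1).coeff z.2) *
        (s ^ (z.1.1 + z.1.2.2.1) * t ^ z.2) := fun z =>
      mul_nonneg (markedLaw_weight_nonneg hK ha hb hc hd z) (by positivity)
    have hsum := (summable_prod_of_nonneg hnn).2 ⟨fun i => (hrow i).summable, by
      simp_rw [fun i => (hrow i).tsum_eq]; exact h4.summable⟩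
    have h5 := hsum.hasSum.prod_fiberwise hrow
    convert! hsum.hasSum using 1
    rw [h5.unique h4]
    simp only [eval_add]
    ring_nf
  all_goals
    have := ha.eval ht
    have := hb.eval ht
    have := hc.eval ht
    have := hd.eval ht
    intro i
    positivity

theorem integrable_markedLaw_iff {f : (Fin 2 → ℕ) → ℝ} :
    Integrable f (markedLaw K a b c d) ↔ Summable fun z : (ℕ × ℕ × ℕ × ℕ) × ℕ =>
      (K * clusterWeight z.1 * (clusterSize a b c d z.1).coeff z.2) *
        ‖f ![z.1.1 + z.1.2.2.1, z.2]‖ := by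
  rw [markedLaw, integrable_sum_dirac_iff (by simp)]
  congrm Summable (fun z => ?_ * _)
  rw [ENNReal.toReal_ofReal (markedLaw_weight_nonneg hK ha hb hc hd z)]

theorem hasSum_integral_markedLaw {f : (Fin 2 → ℕ) → ℝ}
    (hf : Integrable f (markedLaw K a b c d)) :
    HasSum (fun z : (ℕ × ℕ × ℕ × ℕ) × ℕ =>
      (K * clusterWeight z.1 * (clusterSize a b c d z.1).coeff z.2) *
        f ![z.1.1 + z.1.2.2.1, z.2]) (∫ x, f x ∂(markedLaw K a b c d)) := by
  have h : ∀ z : (ℕ × ℕ × ℕ × ℕ) × ℕ, (ENNReal.ofReal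
      (K * clusterWeight z.1 * (clusterSize a b c d z.1).coeff z.2)).toReal =
      K * clusterWeight z.1 * (clusterSize a b c d z.1).coeff z.2 := fun z =>
    ENNReal.toReal_ofReal (markedLaw_weight_nonneg hK ha hb hc hd z)
  have := hasSum_integral_sum_dirac
    (c := fun z : (ℕ × ℕ × ℕ × ℕ) × ℕ => ENNReal.ofReal
      (K * clusterWeight z.1 * (clusterSize a b c d z.1).coeff z.2))
    (x := fun z => ![z.1.1 + z.1.2.2.1, z.2]) (f := f) (by simp) (by
      simp only [h]; exact (integrable_markedLaw_iff hK ha hb hc hd).1 hf)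
  simp only [h, smul_eq_mul] at this
  exact this

theorem hasSum_pairing_markedLaw {f : (Fin 2 → ℕ) → ℝ}
    (hf : Integrable f (markedLaw K a b c d)) :
    HasSum (fun i : ℕ × ℕ × ℕ × ℕ => K * clusterWeight i *
      pairing (fun y => f ![i.1 + i.2.2.1, y]) (clusterSize a b c d i))
      (∫ x, f x ∂(markedLaw K a b c d)) := by
  refine (hasSum_integral_markedLaw hK ha hb hc hd hf).prod_fiberwise fun i => ?_
  simpa only [mul_assoc] using ((hasSum_pairing (fun y => f ![i.1 + i.2.2.1, y])
    (clusterSize a b c d i)).mul_left (K * clusterWeight i))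

theorem integrable_pgf_markedLaw {s t : ℝ} (hs : 0 ≤ s) (ht : 0 ≤ t) :
    Integrable (fun x => s ^ x 0 * t ^ x 1) (markedLaw K a b c d) := by
  rw [integrable_markedLaw_iff hK ha hb hc hd]
  refine (markedLaw_hasSum_pgf hK ha hb hc hd hs ht).summable.congr fun z => ?_
  simp [abs_of_nonneg, hs, ht]

theorem integral_pgf_markedLaw {s t : ℝ} (hs : 0 ≤ s) (ht : 0 ≤ t) :
    ∫ x, s ^ x 0 * t ^ x 1 ∂(markedLaw K a b c d) =
      K * Real.exp (s * (c + a).eval t + (d + b).eval t) := by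
  refine (hasSum_integral_markedLaw hK ha hb hc hd
    (integrable_pgf_markedLaw hK ha hb hc hd hs ht)).unique ?_
  simpa using markedLaw_hasSum_pgf hK ha hb hc hd hs ht

theorem isFiniteMeasure_markedLaw : IsFiniteMeasure (markedLaw K a b c d) := by
  have h := integrable_pgf_markedLaw hK ha hb hc hd zero_le_one zero_le_one
  simp only [one_pow, mul_one] at h
  exact (integrable_const_iff_isFiniteMeasure one_ne_zero).1 h

/-- A law on `ℕ × ℕ` is the marked cluster law as soon as it has its generating function. -/
theorem eq_markedLaw {μ : Measure (Fin 2 → ℕ)} [IsFiniteMeasure μ]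
    (h : ∀ s ∈ Set.Icc (0 : ℝ) 1, ∀ t ∈ Set.Icc (0 : ℝ) 1, ∫ x, s ^ x 0 * t ^ x 1 ∂μ =
      K * Real.exp (s * (c + a).eval t + (d + b).eval t)) :
    μ = markedLaw K a b c d := by
  have := isFiniteMeasure_markedLaw hK ha hb hc hd
  refine measure_ext_of_pgf fun u hu => ?_
  simp only [Fin.prod_univ_two]
  rw [h _ (hu 0) _ (hu 1), integral_pgf_markedLaw hK ha hb hc hd (hu 0).1 (hu 1).1]

/-- Marking the clusters of the stochastically larger class `b` instead of those of `a` increases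
the supermodular order. Given the numbers `k`, `l` of clusters of the two classes, the inequality
holds for the sum of the terms for `(k, l)` and `(l, k)`: if `k ≤ l`, then `a ^ k * b ^ l` dominates
`a ^ l * b ^ k` stochastically, and `y ↦ ζ(l, y) - ζ(k, y)` is monotone. -/
theorem markedLaw_supermodular (hab : StLE a b) {ζ : (Fin 2 → ℝ) → ℝ} (hζ : IsSupermodular ζ)
    (hi : Integrable (fun x : Fin 2 → ℕ => ζ ![(x 0 : ℝ), (x 1 : ℝ)]) (markedLaw K a b c d))
    (hi' : Integrable (fun x : Fin 2 → ℕ => ζ ![(x 0 : ℝ), (x 1 : ℝ)]) (markedLaw K b a c d)) :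
    ∫ x, ζ ![(x 0 : ℝ), (x 1 : ℝ)] ∂(markedLaw K a b c d) ≤
      ∫ x, ζ ![(x 0 : ℝ), (x 1 : ℝ)] ∂(markedLaw K b a c d) := by
  have h1 := hasSum_pairing_markedLaw hK ha hb hc hd hi
  have h2 := hasSum_pairing_markedLaw hK hb ha hc hd hi'
  -- The sums are symmetrized by exchanging the numbers of clusters of the classes `a` and `b`.
  let σ : ℕ × ℕ × ℕ × ℕ ≃ ℕ × ℕ × ℕ × ℕ :=
    (Equiv.refl ℕ).prodCongr ((Equiv.refl ℕ).prodCongr (Equiv.prodComm ℕ ℕ))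
  have h1' := h1.add ((Equiv.hasSum_iff σ).2 h1)
  have h2' := h2.add ((Equiv.hasSum_iff σ).2 h2)
  suffices H : ∀ x e k l : ℕ, k ≤ l →
      pairing (fun y : ℕ => ζ ![(x : ℝ) + k, (y : ℝ)]) (c ^ x * (d ^ e * (a ^ k * b ^ l))) +
      pairing (fun y : ℕ => ζ ![(x : ℝ) + l, (y : ℝ)]) (c ^ x * (d ^ e * (a ^ l * b ^ k))) ≤
      pairing (fun y : ℕ => ζ ![(x : ℝ) + k, (y : ℝ)]) (c ^ x * (d ^ e * (a ^ l * b ^ k))) +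
      pairing (fun y : ℕ => ζ ![(x : ℝ) + l, (y : ℝ)]) (c ^ x * (d ^ e * (a ^ k * b ^ l))) by
    have h3 := hasSum_le ?_ h1' h2'
    · linarith
    rintro ⟨x, e, k, l⟩
    have hw : clusterWeight (x, e, l, k) = clusterWeight (x, e, k, l) := by
      simp only [clusterWeight]; ring
    simp only [σ, Function.comp, Equiv.prodCongr_apply, Equiv.coe_refl, Prod.map, id,
      Equiv.prodComm_apply, Prod.swap, hw, ← mul_add]
    refine mul_le_mul_of_nonneg_left ?_ (mul_nonneg hK (clusterWeight_nonneg _))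
    simp only [clusterSize, Matrix.cons_val_zero, Matrix.cons_val_one, Nat.cast_add]
    rw [mul_comm (b ^ k), mul_comm (b ^ l)]
    rcases le_total k l with hkl | hkl
    · linarith [H x e k l hkl]
    · linarith [H x e l k hkl]
  intro x e k l hkl
  have hst : StLE (c ^ x * (d ^ e * (a ^ l * b ^ k))) (c ^ x * (d ^ e * (a ^ k * b ^ l))) := by
    obtain ⟨m, rfl⟩ := Nat.exists_eq_add_of_le hkl
    have h := (hab.pow ha hb m).mul_left
      ((hc.pow x).mul ((hd.pow e).mul ((ha.pow k).mul (hb.pow k))))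
    convert h using 1 <;> ring
  have hmono : Monotone fun y : ℕ => ζ ![(x : ℝ) + l, (y : ℝ)] - ζ ![(x : ℝ) + k, (y : ℝ)] := by
    intro y z hyz
    have := hζ.exchange (k := (x : ℝ) + k) (l := (x : ℝ) + l) (y := y) (z := z)
      (by gcongr) (by gcongr)
    simp only
    linarith
  have := hst _ hmono
  rw [pairing_sub_fun, pairing_sub_fun] at this
  linarith

end

/-- Two ways of marking the clusters of one Poisson family of clusters with size intensity `Λ`: the
marked clusters have size intensity `p` in `μ` and `q` in `ν`. The part `p ⊓ q` common to `p` and `q`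
can be marked in both cases, so that only the disjoint parts `p - p ⊓ q` and `q - p ⊓ q` have to
be compared. -/
theorem integral_le_of_marking {p q Λ : ℝ[X]} (hp : CoeffNonneg p) (hq : CoeffNonneg q)
    (hpΛ : ∀ k, p.coeff k ≤ Λ.coeff k) (hqΛ : ∀ k, q.coeff k ≤ Λ.coeff k) (hpq : StLE p q)
    {μ ν : Measure (Fin 2 → ℕ)} [IsFiniteMeasure μ] [IsFiniteMeasure ν]
    (hμ : ∀ s ∈ Set.Icc (0 : ℝ) 1, ∀ t ∈ Set.Icc (0 : ℝ) 1, ∫ x, s ^ x 0 * t ^ x 1 ∂μ =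
      Real.exp ((s - 1) * p.eval t + (Λ.eval t - Λ.eval 1)))
    (hν : ∀ s ∈ Set.Icc (0 : ℝ) 1, ∀ t ∈ Set.Icc (0 : ℝ) 1, ∫ x, s ^ x 0 * t ^ x 1 ∂ν =
      Real.exp ((s - 1) * q.eval t + (Λ.eval t - Λ.eval 1)))
    {ζ : (Fin 2 → ℝ) → ℝ} (hζ : IsSupermodular ζ)
    (hi : Integrable (fun x : Fin 2 → ℕ => ζ ![(x 0 : ℝ), (x 1 : ℝ)]) μ)
    (hi' : Integrable (fun x : Fin 2 → ℕ => ζ ![(x 0 : ℝ), (x 1 : ℝ)]) ν) :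
    ∫ x, ζ ![(x 0 : ℝ), (x 1 : ℝ)] ∂μ ≤ ∫ x, ζ ![(x 0 : ℝ), (x 1 : ℝ)] ∂ν := by
  obtain ⟨c, hcc⟩ : ∃ c : ℝ[X], ∀ k, c.coeff k = min (p.coeff k) (q.coeff k) := by
    refine ⟨∑ k ∈ Finset.range (max p.natDegree q.natDegree + 1),
      monomial k (min (p.coeff k) (q.coeff k)), fun k => ?_⟩
    simp only [finsetSum_coeff, coeff_monomial, Finset.sum_ite_eq', Finset.mem_range]
    split_ifs with h
    · rfl
    · rw [coeff_eq_zero_of_natDegree_lt (by lia), coeff_eq_zero_of_natDegree_lt (by lia), min_self]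
  have hc : CoeffNonneg c := fun k => by rw [hcc]; exact le_min (hp k) (hq k)
  have ha : CoeffNonneg (p - c) := fun k => by
    rw [coeff_sub, hcc]; exact sub_nonneg.2 (min_le_left _ _)
  have hb : CoeffNonneg (q - c) := fun k => by
    rw [coeff_sub, hcc]; exact sub_nonneg.2 (min_le_right _ _)
  -- `Λ - p - q + p ⊓ q` is `Λ - p ⊔ q`.
  have hd : CoeffNonneg (Λ - p - q + c) := fun k => by
    simp only [coeff_add, coeff_sub, hcc]
    have := max_le (hpΛ k) (hqΛ k)
    linarith [min_add_max (p.coeff k) (q.coeff k)]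
  have hK := (Real.exp_pos (-Λ.eval 1)).le
  have hab : StLE (p - c) (q - c) := fun f hf => by
    rw [map_sub, map_sub]; linarith [hpq f hf]
  obtain rfl : μ = markedLaw (Real.exp (-Λ.eval 1)) (p - c) (q - c) c (Λ - p - q + c) := by
    refine eq_markedLaw hK ha hb hc hd fun s hs t ht => ?_
    rw [hμ s hs t ht, ← Real.exp_add]
    congr 1
    simp only [eval_add, eval_sub]
    ring
  obtain rfl : ν = markedLaw (Real.exp (-Λ.eval 1)) (q - c) (p - c) c (Λ - p - q + c) := by
    refine eq_markedLaw hK hb ha hc hd fun s hs t ht => ?_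
    rw [hν s hs t ht, ← Real.exp_add]
    congr 1
    simp only [eval_add, eval_sub]
    ring
  exact markedLaw_supermodular hK ha hb hc hd hab hζ hi hi'

end MarkedClusters

/-! ### Rooted trees and the change of root -/

section RootedTrees

open SimpleGraph

variable {V : Type*} {T : SimpleGraph V}

/-- The children of `v` are the vertices whose path to the root starts with the edge to `v`. -/
theorem mem_ch_iff (hT : T.IsTree) {r v j : V} :
    j ∈ ch T r v ↔ ∃ (h : T.Adj j v) (q : T.Walk v r), (Walk.cons h q).IsPath := by
  classical
  constructor
  · rintro ⟨⟨hne, p, hp, hv⟩, hadj⟩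
    refine ⟨hadj.symm, p.dropUntil v hv, ?_⟩
    have hsingle : p.takeUntil v hv = Walk.cons hadj.symm Walk.nil :=
      (hT.existsUnique_path j v).unique (hp.takeUntil hv) (by simp [hne])
    have h := p.take_spec hv
    rw [hsingle, Walk.cons_append, Walk.nil_append] at h
    rwa [h]
  · rintro ⟨h, q, hq⟩
    exact ⟨⟨h.ne, _, hq, by simp⟩, h.symm⟩

theorem adj_of_mem_ch {r v j : V} (h : j ∈ ch T r v) : T.Adj v j := h.2

theorem ne_root_of_mem_ch (hT : T.IsTree) {r v j : V} (h : j ∈ ch T r v) : j ≠ r := by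
  rintro rfl
  simpa using dist_lt_of_mem_ch hT h

theorem exists_mem_ch (hT : T.IsTree) {r j : V} (h : j ≠ r) : ∃ v, j ∈ ch T r v := by
  obtain ⟨p, hp, -⟩ := hT.existsUnique_path j r
  cases p with
  | nil => exact absurd rfl h
  | cons h' q => exact ⟨_, (mem_ch_iff hT).2 ⟨h', q, hp⟩⟩

theorem eq_of_mem_ch (hT : T.IsTree) {r v v' j : V} (h : j ∈ ch T r v) (h' : j ∈ ch T r v') :
    v = v' := by
  obtain ⟨a, q, hq⟩ := (mem_ch_iff hT).1 h
  obtain ⟨a', q', hq'⟩ := (mem_ch_iff hT).1 h'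
  have := (hT.existsUnique_path j r).unique hq hq'
  injection this

theorem mem_ch_root (hT : T.IsTree) {r r' : V} (h : T.Adj r r') : r' ∈ ch T r r :=
  (mem_ch_iff hT).2 ⟨h.symm, Walk.nil, by simp [h.ne']⟩

/-- Moving the root along an edge only changes the parent relation on that edge. -/
theorem mem_ch_of_adj_root (hT : T.IsTree) {r r' v j : V} (h : T.Adj r r') (hj : j ∈ ch T r v)
    (hne : ¬(v = r ∧ j = r')) : j ∈ ch T r' v := by
  classical
  obtain ⟨a, q, hq⟩ := (mem_ch_iff hT).1 hj
  have hq' := (Walk.cons_isPath_iff a q).1 hq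
  by_cases hr : r' ∈ q.support
  · exact (mem_ch_iff hT).2 ⟨a, q.takeUntil r' hr, (Walk.cons_isPath_iff _ _).2
      ⟨hq'.1.takeUntil hr, fun h => hq'.2 (q.support_takeUntil_subset_support hr h)⟩⟩
  · have hjr : j ≠ r' := by
      rintro rfl
      have := eq_of_mem_ch hT hj (mem_ch_root hT h)
      exact hne ⟨this, rfl⟩
    exact (mem_ch_iff hT).2 ⟨a, q.concat h, (Walk.cons_isPath_iff _ _).2
      ⟨hq'.1.concat hr h, by simp [Walk.support_concat, hq'.2, hjr]⟩⟩

/-- Induction from the leaves of a rooted tree to its root. -/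
theorem ch_induction [Finite V] (hT : T.IsTree) (r : V) {p : V → Prop}
    (h : ∀ v, (∀ j ∈ ch T r v, p j) → p v) (v : V) : p v := by
  have := Fintype.ofFinite V
  induction hn : Finset.univ.sup (fun u => T.dist u r) - T.dist v r using
    Nat.strong_induction_on generalizing v with
  | _ n ih =>
    refine h v fun j hj => ih _ ?_ j rfl
    have h1 := dist_lt_of_mem_ch hT hj
    have h2 := Finset.le_sup (f := fun u => T.dist u r) (Finset.mem_univ j)
    lia

variable [Fintype V] (hT : T.IsTree) (α : Sym2 V → unitInterval)

open Classical in
theorem eta_eq (r : V) (t : V → ℝ) (v : V) :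
    eta T hT α r t v = t v * ∏ j, if j ∈ ch T r v then
      (1 - (α s(v, j) : ℝ) + (α s(v, j) : ℝ) * eta T hT α r t j) else 1 := by
  rw [eta, Finset.prod_ite, Finset.prod_const_one, mul_one]
  congr 1
  exact (Finset.prod_subtype _ (fun x => by simp)
    (fun j => 1 - (α s(v, j) : ℝ) + (α s(v, j) : ℝ) * eta T hT α r t j)).symm

theorem eta_congr {r r' : V} {t t' : V → ℝ} {v : V} (ht : t v = t' v)
    (hch : ∀ j, j ∈ ch T r v ↔ j ∈ ch T r' v)
    (h : ∀ j ∈ ch T r v, eta T hT α r t j = eta T hT α r' t' j) :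
    eta T hT α r t v = eta T hT α r' t' v := by
  classical
  rw [eta_eq, eta_eq, ht]
  congr 1
  refine Finset.prod_congr rfl fun j _ => ?_
  by_cases hj : j ∈ ch T r v
  · rw [if_pos hj, if_pos ((hch j).1 hj), h j hj]
  · rw [if_neg hj, if_neg fun h' => hj ((hch j).2 h')]

open Classical in
theorem eta_eq_mul_of_mem {r : V} {t : V → ℝ} {v j : V} (hj : j ∈ ch T r v) :
    eta T hT α r t v = t v * (1 - (α s(v, j) : ℝ) + (α s(v, j) : ℝ) * eta T hT α r t j) *
      ∏ i ∈ Finset.univ.erase j, if i ∈ ch T r v then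
      (1 - (α s(v, i) : ℝ) + (α s(v, i) : ℝ) * eta T hT α r t i) else 1 := by
  rw [eta_eq, ← Finset.mul_prod_erase Finset.univ _ (Finset.mem_univ j), if_pos hj, mul_assoc]

theorem eta_eq_one_of_dist_lt {r : V} {t : V → ℝ} {n : ℕ} (h : ∀ v, n < T.dist v r → t v = 1)
    (v : V) (hv : n < T.dist v r) : eta T hT α r t v = 1 := by
  classical
  induction v using ch_induction hT r with
  | h v ih =>
    rw [eta_eq, h v hv, one_mul]
    refine Finset.prod_eq_one fun j _ => ?_
    split_ifs with hj
    · rw [ih j hj (hv.trans (dist_lt_of_mem_ch hT hj))]; ring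
    · rfl

theorem eta_one (r v : V) : eta T hT α r (fun _ => 1) v = 1 := by
  classical
  induction v using ch_induction hT r with
  | h v ih =>
    rw [eta_eq, one_mul]
    refine Finset.prod_eq_one fun j _ => ?_
    split_ifs with hj
    · rw [ih j hj]; ring
    · rfl

/-- The variable attached to the root only occurs as a factor of the value at the root. -/
theorem eta_update_root {r : V} {t t' : V → ℝ} (h : ∀ v, v ≠ r → t v = t' v) (v : V)
    (hv : v ≠ r) : eta T hT α r t v = eta T hT α r t' v := by
  induction v using ch_induction hT r with
  | h v ih =>
    exact eta_congr hT α (h v hv) (fun _ => Iff.rfl)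
      fun j hj => ih j hj (ne_root_of_mem_ch hT hj)

open Polynomial in
theorem exists_polynomial_eta (r v : V) :
    ∃ p : ℝ[X], CoeffNonneg p ∧ ∀ t : ℝ, eta T hT α r (fun _ => t) v = p.eval t := by
  classical
  induction v using ch_induction hT r with
  | h v ih =>
    choose! p hp hpt using ih
    refine ⟨X * ∏ j, if j ∈ ch T r v then C (1 - (α s(v, j) : ℝ)) + C (α s(v, j) : ℝ) * p j else 1,
      CoeffNonneg.X.mul (CoeffNonneg.prod _ fun j _ => ?_), fun t => ?_⟩
    · split_ifs with hj
      · exact (CoeffNonneg.C (sub_nonneg.2 (α _).2.2)).add ((CoeffNonneg.C (α _).2.1).mul (hp j hj))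
      · exact CoeffNonneg.C zero_le_one
    · rw [eta_eq, eval_mul, eval_X, eval_prod]
      congr 1
      refine Finset.prod_congr rfl fun j _ => ?_
      split_ifs with hj
      · simp [hpt j hj]
      · simp

open Classical in
/-- The logarithm of the joint probability generating function of the field with `λ = 1`, computed
from the representation rooted at `r`: the innovation at the root, then those at the other vertices,
indexed by the pairs of a parent and its child. -/
noncomputable def logPgf (r : V) (t : V → ℝ) : ℝ :=
  (eta T hT α r t r - 1) + ∑ e : V × V, if e.2 ∈ ch T r e.1 then
    (1 - (α s(e.1, e.2) : ℝ)) * (eta T hT α r t e.2 - 1) else 0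

/-- Moving the root along an edge `r r'` of weight `a`: with `A` and `B` the values at `r` and `r'`
of the two subtrees separated by the edge, both logarithms contain
`A (1 - a + a B) + (1 - a) B = (1 - a) A + B (1 - a + a A)` besides common terms. -/
theorem logPgf_eq_of_adj {r r' : V} (h : T.Adj r r') (t : V → ℝ) :
    logPgf hT α r t = logPgf hT α r' t := by
  classical
  have hr' := mem_ch_root hT h
  have hr := mem_ch_root hT h.symm
  have hnr : r ∉ ch T r r' := fun h => ne_root_of_mem_ch hT h rfl
  have hnr' : r' ∉ ch T r' r := fun h => ne_root_of_mem_ch hT h rfl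
  have hiff : ∀ v j, ¬(v = r ∧ j = r') → ¬(v = r' ∧ j = r) → (j ∈ ch T r v ↔ j ∈ ch T r' v) :=
    fun v j h1 h2 => ⟨fun hj => mem_ch_of_adj_root hT h hj h1,
      fun hj => mem_ch_of_adj_root hT h.symm hj h2⟩
  have hη : ∀ v, v ≠ r → v ≠ r' → eta T hT α r t v = eta T hT α r' t v := by
    intro v
    induction v using ch_induction hT r with
    | h v ih =>
      intro h1 h2
      refine eta_congr hT α rfl (fun j => hiff v j (fun e => h1 e.1) fun e => h2 e.1)
        fun j hj => ih j hj (ne_root_of_mem_ch hT hj) ?_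
      rintro rfl
      exact h1 (eq_of_mem_ch hT hj hr')
  have hprod : ∀ v i, (v = r ∧ i ≠ r') ∨ (v = r' ∧ i ≠ r) →
      (if i ∈ ch T r v then (1 - (α s(v, i) : ℝ) + (α s(v, i) : ℝ) * eta T hT α r t i) else 1) =
      (if i ∈ ch T r' v then (1 - (α s(v, i) : ℝ) + (α s(v, i) : ℝ) * eta T hT α r' t i)
        else 1) := by
    intro v i hvi
    have hi : i ∈ ch T r v ↔ i ∈ ch T r' v := by
      rcases hvi with ⟨rfl, hi⟩ | ⟨rfl, hi⟩
      · exact hiff _ _ (fun e => hi e.2) (fun e => h.ne e.1)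
      · exact hiff _ _ (fun e => h.ne e.1.symm) (fun e => hi e.2)
    by_cases hc : i ∈ ch T r v
    · rw [if_pos hc, if_pos (hi.1 hc), hη i (ne_root_of_mem_ch hT hc)
        (ne_root_of_mem_ch hT (hi.1 hc))]
    · rw [if_neg hc, if_neg fun h => hc (hi.2 h)]
  have h1 : eta T hT α r t r =
      eta T hT α r' t r * (1 - (α s(r, r') : ℝ) + (α s(r, r') : ℝ) * eta T hT α r t r') := by
    rw [eta_eq_mul_of_mem hT α hr', eta_eq hT α r' t r,
      ← Finset.mul_prod_erase Finset.univ _ (Finset.mem_univ r'), if_neg hnr',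
      Finset.prod_congr rfl fun i hi => hprod r i (Or.inl ⟨rfl, Finset.ne_of_mem_erase hi⟩)]
    ring
  have h2 : eta T hT α r' t r' =
      eta T hT α r t r' * (1 - (α s(r, r') : ℝ) + (α s(r, r') : ℝ) * eta T hT α r' t r) := by
    rw [eta_eq_mul_of_mem hT α hr, eta_eq hT α r t r',
      ← Finset.mul_prod_erase Finset.univ _ (Finset.mem_univ r), if_neg hnr,
      Finset.prod_congr rfl fun i hi => hprod r' i (Or.inr ⟨rfl, Finset.ne_of_mem_erase hi⟩),
      Sym2.eq_swap]
    ring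
  have h3 := Fintype.sum_eq_add
    (f := fun e : V × V => (if e.2 ∈ ch T r e.1 then
        (1 - (α s(e.1, e.2) : ℝ)) * (eta T hT α r t e.2 - 1) else 0) -
      (if e.2 ∈ ch T r' e.1 then
        (1 - (α s(e.1, e.2) : ℝ)) * (eta T hT α r' t e.2 - 1) else 0))
    (r, r') (r', r) (fun e => h.ne (congrArg Prod.fst e)) (by
      rintro ⟨v, j⟩ ⟨hn1, hn2⟩
      have hi := hiff v j (fun e => hn1 (Prod.ext e.1 e.2)) (fun e => hn2 (Prod.ext e.1 e.2))
      by_cases hc : j ∈ ch T r v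
      · simp only [if_pos hc, if_pos (hi.1 hc), hη j (ne_root_of_mem_ch hT hc)
          (ne_root_of_mem_ch hT (hi.1 hc)), sub_self]
      · simp only [if_neg hc, if_neg fun h => hc (hi.2 h), sub_self])
  rw [Finset.sum_sub_distrib] at h3
  simp only [if_pos hr, if_pos hr', if_neg hnr, if_neg hnr', Sym2.eq_swap (a := r') (b := r)] at h3
  unfold logPgf
  linear_combination h3 + h1 - h2

theorem logPgf_eq (r r' : V) (t : V → ℝ) : logPgf hT α r t = logPgf hT α r' t := by
  obtain ⟨p⟩ := hT.1 r r'
  induction p with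
  | nil => rfl
  | cons h _ ih => exact (logPgf_eq_of_adj hT α h t).trans ih

theorem logPgf_one (r : V) : logPgf hT α r (fun _ => 1) = 0 := by
  simp [logPgf, eta_one]

open Classical in
/-- Multiplying the variable of the root by `s`. -/
theorem logPgf_mul_root (r : V) (s : ℝ) (t : V → ℝ) :
    logPgf hT α r (Function.update t r (s * t r)) =
      (s - 1) * eta T hT α r t r + logPgf hT α r t := by
  have h : ∀ v ≠ r, eta T hT α r (Function.update t r (s * t r)) v = eta T hT α r t v :=
    eta_update_root hT α fun v hv => Function.update_of_ne hv _ _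
  have hr : eta T hT α r (Function.update t r (s * t r)) r = s * eta T hT α r t r := by
    rw [eta_eq, eta_eq hT α r t r, Function.update_self, mul_assoc]
    congr 2
    refine Finset.prod_congr rfl fun j _ => ?_
    split_ifs with hj
    · rw [h j (ne_root_of_mem_ch hT hj)]
    · rfl
  have hsum : ∀ e : V × V, (if e.2 ∈ ch T r e.1 then (1 - (α s(e.1, e.2) : ℝ)) *
      (eta T hT α r (Function.update t r (s * t r)) e.2 - 1) else 0) =
      if e.2 ∈ ch T r e.1 then (1 - (α s(e.1, e.2) : ℝ)) * (eta T hT α r t e.2 - 1) else 0 := by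
    intro e
    split_ifs with he
    · rw [h _ (ne_root_of_mem_ch hT he)]
    · rfl
  unfold logPgf
  rw [hr, Finset.sum_congr rfl fun e _ => hsum e]
  ring

open Classical in
/-- Pruning a vertex `j` farthest from the root among those with a nontrivial variable: its variable
is passed on to its parent `p` through the thinning. -/
theorem logPgf_prune {r p j : V} (hj : j ∈ ch T r p) {t : V → ℝ}
    (ht : ∀ v, T.dist j r < T.dist v r → t v = 1) :
    logPgf hT α r t = logPgf hT α r (Function.update (Function.update t j 1) p
      (t p * (1 - (α s(p, j) : ℝ) + (α s(p, j) : ℝ) * t j))) +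
      (1 - (α s(p, j) : ℝ)) * (t j - 1) := by
  set t' := Function.update (Function.update t j 1) p
      (t p * (1 - (α s(p, j) : ℝ) + (α s(p, j) : ℝ) * t j)) with ht'
  have hpj : j ≠ p := (adj_of_mem_ch hj).ne'
  have ht'j : t' j = 1 := by simp [t', hpj]
  have ht'p : t' p = t p * (1 - (α s(p, j) : ℝ) + (α s(p, j) : ℝ) * t j) := by simp [t']
  have hd := dist_lt_of_mem_ch hT hj
  have ht1 : ∀ v, T.dist j r < T.dist v r → t' v = 1 := by
    intro v hv
    rw [ht', Function.update_of_ne (by rintro rfl; lia), Function.update_of_ne (by rintro rfl; lia),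
      ht v hv]
  have hleaf : ∀ u : V → ℝ, (∀ v, T.dist j r < T.dist v r → u v = 1) →
      eta T hT α r u j = u j := by
    intro u hu
    rw [eta_eq, Finset.prod_eq_one, mul_one]
    intro i _
    split_ifs with hi
    · rw [eta_eq_one_of_dist_lt hT α hu i (dist_lt_of_mem_ch hT hi)]; ring
    · rfl
  have h1 := hleaf t ht
  have h2 := hleaf t' ht1
  rw [ht'j] at h2
  have hη : ∀ v, v ≠ j → eta T hT α r t v = eta T hT α r t' v := by
    intro v
    induction v using ch_induction hT r with
    | h v ih =>
      intro hv
      by_cases hvp : v = p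
      · subst hvp
        rw [eta_eq_mul_of_mem hT α hj, eta_eq_mul_of_mem hT α hj, h1, h2, ht'p]
        have hrest : ∀ i ∈ Finset.univ.erase j, (if i ∈ ch T r v then
            (1 - (α s(v, i) : ℝ) + (α s(v, i) : ℝ) * eta T hT α r t i) else 1) =
            if i ∈ ch T r v then
            (1 - (α s(v, i) : ℝ) + (α s(v, i) : ℝ) * eta T hT α r t' i) else 1 := by
          intro i hi
          split_ifs with hi'
          · rw [ih i hi' (Finset.ne_of_mem_erase hi)]
          · rfl
        rw [Finset.prod_congr rfl hrest]
        ring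
      · refine eta_congr hT α (by simp [t', hv, hvp]) (fun _ => Iff.rfl) fun i hi => ih i hi ?_
        rintro rfl
        exact hvp (eq_of_mem_ch hT hi hj)
  have h3 := Fintype.sum_eq_single
    (f := fun e : V × V => (if e.2 ∈ ch T r e.1 then
        (1 - (α s(e.1, e.2) : ℝ)) * (eta T hT α r t e.2 - 1) else 0) -
      (if e.2 ∈ ch T r e.1 then
        (1 - (α s(e.1, e.2) : ℝ)) * (eta T hT α r t' e.2 - 1) else 0))
    (p, j) (by
      rintro ⟨v, i⟩ hvi
      by_cases hc : i ∈ ch T r v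
      · have : i ≠ j := by
          rintro rfl
          exact hvi (Prod.ext (eq_of_mem_ch hT hc hj) rfl)
        simp only [if_pos hc, hη i this, sub_self]
      · simp only [if_neg hc, sub_self])
  rw [Finset.sum_sub_distrib] at h3
  simp only [if_pos hj, h1, h2] at h3
  unfold logPgf
  rw [hη r (ne_root_of_mem_ch hT hj).symm]
  linear_combination h3

end RootedTrees

/-! ### Poisson thinning -/

section Dynamics

variable {Ω : Type*}

theorem measurable_thinning [MeasurableSpace Ω] {I : ℕ → Ω → ℕ} {N : Ω → ℕ}
    (hI : ∀ i, Measurable (I i)) (hN : Measurable N) : Measurable (thinning I N) := by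
  have h : Measurable fun p : ℕ × Ω => ∑ i ∈ Finset.range p.1, I i p.2 :=
    measurable_from_prod_countable_right fun n => by
      dsimp only
      exact Finset.measurable_fun_sum _ fun i _ => hI i
  exact h.comp (hN.prodMk measurable_id)

/-- Integrating out an innovation `L` and the Bernoulli sequence `I` of a thinning that are
independent of the past `(G, N)`. -/
theorem integral_mul_pow_thinning [MeasurableSpace Ω] {P : Measure Ω} [IsProbabilityMeasure P]
    {G : Ω → ℝ} {N L : Ω → ℕ} {I : ℕ → Ω → ℕ} (hG : Measurable G) (hG1 : ∀ ω, ‖G ω‖ ≤ 1)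
    (hN : Measurable N) (hL : Measurable L) (hI : ∀ i, Measurable (I i))
    (hind : IndepFun (fun ω => (G ω, N ω)) (fun ω => (L ω, fun i => I i ω)) P)
    (hLI : iIndepFun (fun k : Option ℕ => k.elim L I) P) {t : ℝ} (ht : t ∈ Set.Icc (0 : ℝ) 1)
    {x y : ℝ} (hx : ∫ ω, t ^ L ω ∂P = x) (hy : ∀ i, ∫ ω, t ^ I i ω ∂P = y) :
    ∫ ω, G ω * t ^ (L ω + thinning I N ω) ∂P = x * ∫ ω, G ω * y ^ N ω ∂P := by
  have hmU : Measurable fun ω => (G ω, N ω) := hG.prodMk hN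
  have hmY : Measurable fun ω => (L ω, fun i => I i ω) := hL.prodMk (measurable_pi_lambda _ hI)
  have hmF : Measurable fun z : (ℝ × ℕ) × ℕ × (ℕ → ℕ) =>
      z.1.1 * t ^ (z.2.1 + ∑ i ∈ Finset.range z.1.2, z.2.2 i) := by
    have h : Measurable fun p : ℕ × (ℕ → ℕ) => ∑ i ∈ Finset.range p.1, p.2 i :=
      measurable_from_prod_countable_right fun n => by
        dsimp only
        exact Finset.measurable_fun_sum _ fun i _ => measurable_pi_apply i
    have h1 : Measurable fun z : (ℝ × ℕ) × ℕ × (ℕ → ℕ) =>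
        z.2.1 + ∑ i ∈ Finset.range z.1.2, z.2.2 i :=
      (by fun_prop : Measurable fun z : (ℝ × ℕ) × ℕ × (ℕ → ℕ) => z.2.1).add
        (h.comp (by fun_prop : Measurable fun z : (ℝ × ℕ) × ℕ × (ℕ → ℕ) => (z.1.2, z.2.2)))
    have h2 : Measurable fun n : ℕ => t ^ n := measurable_of_countable _
    exact (by fun_prop : Measurable fun z : (ℝ × ℕ) × ℕ × (ℕ → ℕ) => z.1.1).mul (h2.comp h1)
  have hinner : ∀ n : ℕ, ∫ ω, t ^ (L ω + ∑ i ∈ Finset.range n, I i ω) ∂P = x * y ^ n := by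
    intro n
    have hk := hLI.precomp (g := Option.map (Fin.val : Fin n → ℕ))
      (Option.map_injective Fin.val_injective)
    have hm : ∀ k : Option ℕ, Measurable (k.elim L I) := fun k => by
      cases k
      · exact hL
      · exact hI _
    have h := hk.integral_fun_prod_comp (f := fun _ m => t ^ m) (fun k => (hm _).aemeasurable)
      (fun k => (measurable_of_countable _).aestronglyMeasurable)
    simp only [Fintype.prod_option, Option.map_none, Option.map_some, Option.elim_none,
      Option.elim_some, hx, hy, Finset.prod_const, Finset.card_univ, Fintype.card_fin] at h
    rw [← h]
    refine integral_congr_ae (Filter.Eventually.of_forall fun ω => ?_)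
    simp only
    rw [pow_add, Finset.prod_pow_eq_pow_sum, Finset.sum_range]
  have hint : Integrable (fun z : (ℝ × ℕ) × ℕ × (ℕ → ℕ) =>
      z.1.1 * t ^ (z.2.1 + ∑ i ∈ Finset.range z.1.2, z.2.2 i))
      (P.map fun ω => ((G ω, N ω), (L ω, fun i => I i ω))) := by
    rw [integrable_map_measure hmF.aestronglyMeasurable (hmU.prodMk hmY).aemeasurable]
    refine Integrable.of_bound (hmF.comp (hmU.prodMk hmY)).aestronglyMeasurable 1
      (Filter.Eventually.of_forall fun ω => ?_)
    simp only [Function.comp, norm_mul, norm_pow]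
    refine mul_le_one₀ (hG1 ω) (by positivity) (pow_le_one₀ (norm_nonneg _) ?_)
    rw [Real.norm_of_nonneg ht.1]; exact ht.2
  have h1 := integral_map (hmU.prodMk hmY).aemeasurable hmF.aestronglyMeasurable (μ := P)
  have hprod := hind.map_prod_eq_prod_map_map hmU.aemeasurable hmY.aemeasurable
  rw [hprod] at hint h1
  have : IsProbabilityMeasure (P.map fun ω => (G ω, N ω)) :=
    Measure.isProbabilityMeasure_map hmU.aemeasurable
  have : IsProbabilityMeasure (P.map fun ω => (L ω, fun i => I i ω)) :=
    Measure.isProbabilityMeasure_map hmY.aemeasurable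
  rw [integral_prod _ hint] at h1
  have h2 : ∀ u : ℝ × ℕ, ∫ z, u.1 * t ^ (z.1 + ∑ i ∈ Finset.range u.2, z.2 i)
      ∂(P.map fun ω => (L ω, fun i => I i ω)) = u.1 * (x * y ^ u.2) := by
    intro u
    rw [integral_const_mul, ← hinner u.2, integral_map hmY.aemeasurable]
    have hm : Measurable fun z : ℕ × (ℕ → ℕ) => z.1 + ∑ i ∈ Finset.range u.2, z.2 i :=
      measurable_fst.add (Finset.measurable_fun_sum _ fun i _ =>
        (measurable_pi_apply i).comp measurable_snd)
    exact ((measurable_of_countable fun n : ℕ => t ^ n).comp hm).aestronglyMeasurable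
  simp only [h2] at h1
  rw [integral_map hmU.aemeasurable] at h1
  · simp only [thinning]
    rw [← h1, ← integral_const_mul]
    exact integral_congr_ae (Filter.Eventually.of_forall fun ω => by ring)
  · have h2 : Measurable fun n : ℕ => y ^ n := measurable_of_countable _
    exact (measurable_fst.mul (measurable_const.mul (h2.comp measurable_snd))).aestronglyMeasurable

variable {V : Type*} {T : SimpleGraph V}

/-- The variables of the stochastic representation can be made measurable by moving the points of
a null set to a point outside of it; the recursion still holds at every point. -/
theorem IsPoissonDynamics.exists_measurable [Fintype V] [MeasurableSpace Ω] {P : Measure Ω}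
    [IsProbabilityMeasure P] {lam : ℝ} {α : Sym2 V → unitInterval} {r : V} {L : V → Ω → ℕ}
    {I : V → ℕ → Ω → ℕ} {N : V → Ω → ℕ} (hT : T.IsTree)
    (h : IsPoissonDynamics P lam α T r L I N) :
    ∃ φ : Ω → Ω, (∀ᵐ ω ∂P, φ ω = ω) ∧ (∀ v, Measurable (L v ∘ φ)) ∧
      (∀ v ≠ r, ∀ i, Measurable (I v i ∘ φ)) := by
  classical
  have hL : ∀ v, AEMeasurable (L v) P := by
    intro v
    by_cases hv : v = r
    · subst hv; exact h.hasLaw_root.aemeasurable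
    · obtain ⟨p, hp⟩ := exists_mem_ch hT hv
      exact (h.hasLaw_child p v hp).aemeasurable
  have hI : ∀ v : {v // v ≠ r}, ∀ i, AEMeasurable (I v i) P := by
    intro v i
    obtain ⟨p, hp⟩ := exists_mem_ch hT v.2
    exact (h.hasLaw_thinning p v hp i).aemeasurable
  have hae : ∀ᵐ ω ∂P, (∀ v, L v ω = (hL v).mk _ ω) ∧
      ∀ (v : {v // v ≠ r}) i, I v i ω = (hI v i).mk _ ω :=
    (ae_all_iff.2 fun v => (hL v).ae_eq_mk).and
      (ae_all_iff.2 fun v => ae_all_iff.2 fun i => (hI v i).ae_eq_mk)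
  obtain ⟨S, hSsub, hS, hS0⟩ := exists_measurable_superset_of_null hae
  have hSc : ∀ᵐ ω ∂P, ω ∉ S := measure_eq_zero_iff_ae_notMem.1 hS0
  obtain ⟨ω₀, hω₀⟩ := hSc.exists
  have hgood : ∀ ω, ω ∉ S → (∀ v, L v ω = (hL v).mk _ ω) ∧
      ∀ (v : {v // v ≠ r}) i, I v i ω = (hI v i).mk _ ω := by
    intro ω hω
    by_contra hc
    exact hω (hSsub hc)
  let φ : Ω → Ω := fun ω => if ω ∈ S then ω₀ else ω
  have hφ : Measurable φ := Measurable.ite hS measurable_const measurable_id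
  have hφS : ∀ ω, φ ω ∉ S := by
    intro ω
    by_cases hω : ω ∈ S
    · simp [φ, hω, hω₀]
    · simp [φ, hω]
  refine ⟨φ, hSc.mono fun ω hω => by simp [φ, hω], fun v => ?_, fun v hv i => ?_⟩
  · rw [show L v ∘ φ = (hL v).mk _ ∘ φ from funext fun ω => (hgood _ (hφS ω)).1 v]
    exact (hL v).measurable_mk.comp hφ
  · rw [show I v i ∘ φ = (hI ⟨v, hv⟩ i).mk _ ∘ φ from
      funext fun ω => (hgood _ (hφS ω)).2 ⟨v, hv⟩ i]
    exact (hI ⟨v, hv⟩ i).measurable_mk.comp hφ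

theorem IsPoissonDynamics.comp [MeasurableSpace Ω] {P : Measure Ω}
    {lam : ℝ} {α : Sym2 V → unitInterval} {r : V} {L : V → Ω → ℕ}
    {I : V → ℕ → Ω → ℕ} {N : V → Ω → ℕ} (h : IsPoissonDynamics P lam α T r L I N)
    {φ : Ω → Ω} (hφ : ∀ᵐ ω ∂P, φ ω = ω) :
    IsPoissonDynamics P lam α T r (fun v => L v ∘ φ) (fun v i => I v i ∘ φ)
      (fun v => N v ∘ φ) where
  hasLaw_root := h.hasLaw_root.congr (hφ.mono fun ω hω => by simp [hω])
  hasLaw_child v j hj := (h.hasLaw_child v j hj).congr (hφ.mono fun ω hω => by simp [hω])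
  hasLaw_thinning v j hj i :=
    (h.hasLaw_thinning v j hj i).congr (hφ.mono fun ω hω => by simp [hω])
  indep := h.indep.congr fun k => hφ.mono fun ω hω => by cases k <;> simp [hω]
  eq_root ω := h.eq_root (φ ω)
  eq_child v j hj ω := h.eq_child v j hj (φ ω)

end Dynamics

/-! ### The joint generating function of the field -/

section JointPgf

variable {Ω : Type*} {V : Type*} {T : SimpleGraph V}

/-- The innovations and thinnings used at one vertex are independent of those used elsewhere, hence
of the field at the other vertices that are not farther from the root. -/
theorem IsPoissonDynamics.indepFun_of_dist_le [Fintype V] [mΩ : MeasurableSpace Ω] {P : Measure Ω}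
    [IsProbabilityMeasure P] {lam : ℝ} {α : Sym2 V → unitInterval} {r : V} {L : V → Ω → ℕ}
    {I : V → ℕ → Ω → ℕ} {N : V → Ω → ℕ} (hT : T.IsTree)
    (h : IsPoissonDynamics P lam α T r L I N) (hL : ∀ v, Measurable (L v))
    (hI : ∀ v ≠ r, ∀ i, Measurable (I v i)) {j : V} (hj : j ≠ r) {E : Type*} [MeasurableSpace E]
    {f : ({v : V // v ≠ j ∧ T.dist v r ≤ T.dist j r} → ℕ) → E} (hf : Measurable f) :
    IndepFun (fun ω => f fun v => N v ω) (fun ω => (L j ω, fun i => I j i ω)) P := by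
  let X : V ⊕ ({v : V // v ≠ r} × ℕ) → Ω → ℕ := Sum.elim L fun q => I q.1 q.2
  let vert : V ⊕ ({v : V // v ≠ r} × ℕ) → V := Sum.elim id fun q => q.1
  have hX : ∀ k, Measurable (X k) := fun k => by
    rcases k with v | ⟨v, i⟩
    · exact hL v
    · exact hI v v.2 i
  -- The thinning sequence at the root is unconstrained, possibly not measurable, and left out.
  have hXind : iIndepFun X P := by
    convert h.indep.precomp (g := Sum.map id (Prod.map (Subtype.val : {v : V // v ≠ r} → V) id)) ?_
      using 1
    · ext k; cases k <;> rfl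
    · exact Function.injective_id.sumMap (Subtype.val_injective.prodMap Function.injective_id)
  rw [iIndepFun_iff_iIndep] at hXind
  let m : Set V → MeasurableSpace Ω := fun S => ⨆ k ∈ vert ⁻¹' S, (inferInstance :
    MeasurableSpace ℕ).comap (X k)
  have hXm : ∀ (S : Set V) k, vert k ∈ S → Measurable[m S] (X k) := fun S k hk =>
    (comap_measurable (X k)).mono (le_iSup₂_of_le k hk le_rfl) le_rfl
  have hmind : Indep (m {j}ᶜ) (m {j}) P :=
    indep_iSup_of_disjoint (fun k => (hX k).comap_le) hXind
      (disjoint_compl_left.preimage vert)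
  have hN : ∀ n v, T.dist v r = n → v ≠ j → T.dist v r ≤ T.dist j r →
      Measurable[m {j}ᶜ] (N v) := by
    intro n
    induction n using Nat.strong_induction_on with
    | _ n ih =>
      intro v hv hvj hd
      by_cases hvr : v = r
      · subst hvr
        rw [show N v = X (Sum.inl v) from funext h.eq_root]
        exact hXm _ _ hvj
      · obtain ⟨p, hp⟩ := exists_mem_ch hT hvr
        have hlt := dist_lt_of_mem_ch hT hp
        have hNp := ih _ (hv ▸ hlt) p rfl (by rintro rfl; lia) (by lia)
        rw [show N v = fun ω => L v ω + thinning (I v) (N p) ω from funext (h.eq_child p v hp)]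
        exact (hXm _ (Sum.inl v) hvj).add
          (@measurable_thinning Ω (m {j}ᶜ) _ _ (fun i => hXm _ (Sum.inr (⟨v, hvr⟩, i)) hvj) hNp)
  rw [IndepFun_iff_Indep]
  refine indep_of_indep_of_le_left (indep_of_indep_of_le_right hmind ?_) ?_
  · refine Measurable.comap_le ?_
    have h1 : Measurable[m {j}] (L j) := hXm {j} (Sum.inl j) rfl
    have h2 : Measurable[m {j}] fun ω i => I j i ω :=
      @measurable_pi_lambda _ _ _ (m {j}) _ _ fun i => hXm {j} (Sum.inr (⟨j, hj⟩, i)) rfl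
    exact h1.prodMk h2
  · refine Measurable.comap_le ?_
    exact hf.comp (@measurable_pi_lambda _ _ _ (m {j}ᶜ) _ _ fun v => hN _ v rfl v.2.1 v.2.2)

theorem IsPoissonDynamics.measurable [Fintype V] [mΩ : MeasurableSpace Ω] {P : Measure Ω}
    {lam : ℝ} {α : Sym2 V → unitInterval} {r : V} {L : V → Ω → ℕ}
    {I : V → ℕ → Ω → ℕ} {N : V → Ω → ℕ} (hT : T.IsTree)
    (h : IsPoissonDynamics P lam α T r L I N) (hL : ∀ v, Measurable (L v))
    (hI : ∀ v ≠ r, ∀ i, Measurable (I v i)) (v : V) : Measurable (N v) := by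
  induction hn : T.dist v r using Nat.strong_induction_on generalizing v with
  | _ n ih =>
    by_cases hvr : v = r
    · subst hvr
      rw [show N v = L v from funext h.eq_root]
      exact hL v
    · obtain ⟨p, hp⟩ := exists_mem_ch hT hvr
      rw [show N v = fun ω => L v ω + thinning (I v) (N p) ω from funext (h.eq_child p v hp)]
      exact (hL v).add (measurable_thinning (hI v hvr) (ih _ (hn ▸ dist_lt_of_mem_ch hT hp) p rfl))

theorem integral_pow_of_hasLaw_poisson [MeasurableSpace Ω] {P : Measure Ω} {L : Ω → ℕ} {c : ℝ}
    (hc : 0 ≤ c) (h : HasLaw L (poissonMeasure c.toNNReal) P) (t : ℝ) :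
    ∫ ω, t ^ L ω ∂P = Real.exp (c * (t - 1)) := by
  have h1 := h.integral_comp (f := fun n : ℕ => t ^ n)
    (measurable_of_countable _).aestronglyMeasurable
  rw [integral_pow_poissonMeasure, Real.coe_toNNReal _ hc] at h1
  exact h1

theorem integral_pow_of_hasLaw_bernoulli [MeasurableSpace Ω] {P : Measure Ω} {X : Ω → ℕ}
    {p : unitInterval} (h : HasLaw X (bernoulliMeasure 1 0 p) P) (t : ℝ) :
    ∫ ω, t ^ X ω ∂P = 1 - (p : ℝ) + (p : ℝ) * t := by
  have h1 := h.integral_comp (f := fun n : ℕ => t ^ n)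
    (measurable_of_countable _).aestronglyMeasurable
  rw [integral_bernoulliMeasure] at h1
  refine h1.trans ?_
  simp only [pow_one, pow_zero, smul_eq_mul]
  ring

/-- The joint probability generating function of the field. The vertices are pruned one by one,
starting with those farthest from the root: integrating out the innovation and the thinning of a
vertex changes the variable of its parent as in `logPgf_prune`. -/
theorem IsPoissonDynamics.integral_prod_pow_of_measurable [Fintype V] [MeasurableSpace Ω]
    {P : Measure Ω} [IsProbabilityMeasure P] {lam : ℝ} (hlam : 0 ≤ lam)
    {α : Sym2 V → unitInterval} {r : V} {L : V → Ω → ℕ}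
    {I : V → ℕ → Ω → ℕ} {N : V → Ω → ℕ} (hT : T.IsTree)
    (h : IsPoissonDynamics P lam α T r L I N) (hL : ∀ v, Measurable (L v))
    (hI : ∀ v ≠ r, ∀ i, Measurable (I v i)) (t : V → ℝ) (ht : ∀ v, t v ∈ Set.Icc (0 : ℝ) 1) :
    ∫ ω, ∏ v, t v ^ N v ω ∂P = Real.exp (lam * logPgf hT α r t) := by
  classical
  induction hn : ∑ v, (if t v ≠ 1 then T.dist v r else 0) using
    Nat.strong_induction_on generalizing t with
  | _ n ih =>
    by_cases hall : ∀ v, v ≠ r → t v = 1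
    · have ht' : t = Function.update (fun _ => 1) r (t r * 1) := by
        ext v
        by_cases hv : v = r
        · subst hv; simp
        · simp [hv, hall v hv]
      have h1 : ∀ ω, ∏ v, t v ^ N v ω = t r ^ L r ω := by
        intro ω
        rw [Finset.prod_eq_single r (fun v _ hv => by rw [hall v hv, one_pow]) (by simp),
          h.eq_root]
      have h2 := logPgf_mul_root hT α r (t r) (fun _ => 1)
      rw [← ht', logPgf_one, eta_one] at h2
      simp only [h1]
      rw [integral_pow_of_hasLaw_poisson hlam h.hasLaw_root, h2]
      ring_nf
    push Not at hall
    -- Among the vertices with a nontrivial variable, take one farthest from the root.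
    obtain ⟨j, hjm, hjmax⟩ := Finset.exists_max_image
      (Finset.univ.filter fun v => v ≠ r ∧ t v ≠ 1) (fun v => T.dist v r)
      (by obtain ⟨v, hv⟩ := hall; exact ⟨v, by simpa using hv⟩)
    simp only [Finset.mem_filter, Finset.mem_univ, true_and] at hjm hjmax
    obtain ⟨hjr, htj⟩ := hjm
    have hone : ∀ v, T.dist j r < T.dist v r → t v = 1 := by
      intro v hv
      by_contra hv1
      have := hjmax v ⟨by rintro rfl; simp at hv, hv1⟩
      lia
    obtain ⟨p, hp⟩ := exists_mem_ch hT hjr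
    have hd := dist_lt_of_mem_ch hT hp
    have hpj : p ≠ j := (adj_of_mem_ch hp).ne
    have hprune := logPgf_prune hT α hp hone
    set a : ℝ := (α s(p, j) : ℝ) with ha
    have ha0 : 0 ≤ a := (α s(p, j)).2.1
    have ha1 : a ≤ 1 := (α s(p, j)).2.2
    set y : ℝ := 1 - a + a * t j with hy
    have hy0 : 0 ≤ y := by have := mul_nonneg ha0 (ht j).1; linarith
    have hy1 : y ≤ 1 := by have := mul_le_mul_of_nonneg_left (ht j).2 ha0; linarith
    set t' := Function.update (Function.update t j 1) p (t p * y) with ht'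
    have ht'j : t' j = 1 := by simp [t', hpj.symm]
    have ht'p : t' p = t p * y := by simp [t']
    have ht'v : ∀ v, v ≠ j → v ≠ p → t' v = t v := fun v h1 h2 => by simp [t', h1, h2]
    have ht'01 : ∀ v, t' v ∈ Set.Icc (0 : ℝ) 1 := by
      intro v
      by_cases h1 : v = j
      · subst h1; rw [ht'j]; simp
      by_cases h2 : v = p
      · subst h2
        rw [ht'p]
        exact ⟨mul_nonneg (ht v).1 hy0, mul_le_one₀ (ht v).2 hy0 hy1⟩
      · rw [ht'v v h1 h2]; exact ht v
    -- In the sum, the distance of the pruned vertex is replaced by at most that of its parent, which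
    -- is smaller.
    have hlt : ∑ v, (if t' v ≠ 1 then T.dist v r else 0) < n := by
      rw [← hn, ← Finset.add_sum_erase _ _ (Finset.mem_univ j),
        ← Finset.add_sum_erase Finset.univ (fun v => if t v ≠ 1 then T.dist v r else 0)
          (Finset.mem_univ j),
        ← Finset.add_sum_erase (Finset.univ.erase j) (fun v => if t' v ≠ 1 then T.dist v r else 0)
          (Finset.mem_erase.2 ⟨hpj, Finset.mem_univ p⟩),
        ← Finset.add_sum_erase (Finset.univ.erase j) (fun v => if t v ≠ 1 then T.dist v r else 0)
          (Finset.mem_erase.2 ⟨hpj, Finset.mem_univ p⟩)]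
      have hrest : ∑ v ∈ (Finset.univ.erase j).erase p, (if t' v ≠ 1 then T.dist v r else 0) =
          ∑ v ∈ (Finset.univ.erase j).erase p, (if t v ≠ 1 then T.dist v r else 0) := by
        refine Finset.sum_congr rfl fun v hv => ?_
        rw [Finset.mem_erase, Finset.mem_erase] at hv
        rw [ht'v v hv.2.1 hv.1]
      rw [hrest, ht'j, if_pos htj]
      have : (if t' p ≠ 1 then T.dist p r else 0) ≤ T.dist p r := by split_ifs <;> lia
      simp only [ne_eq, not_true_eq_false, if_false]
      lia
    have hih := ih _ hlt t' ht'01 rfl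
    let G : Ω → ℝ := fun ω => ∏ v ∈ Finset.univ.erase j, t v ^ N v ω
    have hNm := h.measurable hT hL hI
    have hGm : Measurable G := Finset.measurable_fun_prod _ fun v _ =>
      (measurable_of_countable fun n : ℕ => t v ^ n).comp (hNm v)
    have hG1 : ∀ ω, ‖G ω‖ ≤ 1 := by
      intro ω
      rw [Real.norm_of_nonneg (Finset.prod_nonneg fun v _ => pow_nonneg (ht v).1 _)]
      exact Finset.prod_le_one (fun v _ => pow_nonneg (ht v).1 _)
        fun v _ => pow_le_one₀ (ht v).1 (ht v).2
    have hind : IndepFun (fun ω => (G ω, N p ω)) (fun ω => (L j ω, fun i => I j i ω)) P := by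
      have := h.indepFun_of_dist_le hT hL hI hjr
        (f := fun x => (∏ v : {v : V // v ≠ j ∧ T.dist v r ≤ T.dist j r}, t v ^ x v,
          x ⟨p, hpj, hd.le⟩)) (measurable_of_countable _)
      convert this using 4 with ω
      change ∏ v ∈ Finset.univ.erase j, t v ^ N v ω = _
      rw [← Finset.prod_subtype (Finset.univ.filter fun v => v ≠ j ∧ T.dist v r ≤ T.dist j r)
        (fun v => by simp) (fun v => t v ^ N v ω)]
      symm
      refine Finset.prod_subset (fun v hv => ?_) fun v hv hv' => ?_
      · simpa using (Finset.mem_filter.1 hv).2.1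
      · rw [hone v, one_pow]
        by_contra hc
        exact hv' (by simpa using ⟨Finset.ne_of_mem_erase hv, not_lt.1 hc⟩)
    have hLI : iIndepFun (fun k : Option ℕ => k.elim (L j) (I j)) P := by
      convert h.indep.precomp (g := fun k : Option ℕ => k.elim (Sum.inl j) fun i => Sum.inr (j, i)) ?_
        using 1
      · ext k; cases k <;> rfl
      · rintro (_ | i) (_ | i') <;> simp
    have hstep := integral_mul_pow_thinning hGm hG1 (hNm p) (hL j) (hI j hjr) hind hLI (ht j)
      (integral_pow_of_hasLaw_poisson (mul_nonneg hlam (sub_nonneg.2 ha1))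
        (h.hasLaw_child p j hp) (t j))
      (fun i => integral_pow_of_hasLaw_bernoulli (h.hasLaw_thinning p j hp i) (t j))
    have h1 : ∀ ω, ∏ v, t v ^ N v ω = G ω * t j ^ (L j ω + thinning (I j) (N p) ω) := by
      intro ω
      rw [← h.eq_child p j hp ω, mul_comm]
      exact (Finset.mul_prod_erase Finset.univ (fun v => t v ^ N v ω) (Finset.mem_univ j)).symm
    have h2 : ∀ ω, G ω * y ^ N p ω = ∏ v, t' v ^ N v ω := by
      intro ω
      have hpm : p ∈ Finset.univ.erase j := Finset.mem_erase.2 ⟨hpj, Finset.mem_univ p⟩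
      change (∏ v ∈ Finset.univ.erase j, t v ^ N v ω) * _ = _
      rw [← Finset.mul_prod_erase Finset.univ _ (Finset.mem_univ j), ht'j, one_pow, one_mul,
        ← Finset.mul_prod_erase _ _ hpm, ← Finset.mul_prod_erase _ (fun v => t' v ^ N v ω) hpm,
        ht'p, mul_pow]
      have hrest : ∏ v ∈ (Finset.univ.erase j).erase p, t' v ^ N v ω =
          ∏ v ∈ (Finset.univ.erase j).erase p, t v ^ N v ω := by
        refine Finset.prod_congr rfl fun v hv => ?_
        rw [Finset.mem_erase, Finset.mem_erase] at hv
        rw [ht'v v hv.2.1 hv.1]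
      rw [hrest]
      ring
    simp only [h1]
    rw [hstep]
    simp only [← ha, ← hy, h2]
    rw [hih, hprune, ← Real.exp_add]
    ring_nf

theorem IsPoissonDynamics.integral_prod_pow [Fintype V] [MeasurableSpace Ω]
    {P : Measure Ω} [IsProbabilityMeasure P] {lam : ℝ} (hlam : 0 ≤ lam)
    {α : Sym2 V → unitInterval} {r : V} {L : V → Ω → ℕ}
    {I : V → ℕ → Ω → ℕ} {N : V → Ω → ℕ} (hT : T.IsTree)
    (h : IsPoissonDynamics P lam α T r L I N) (t : V → ℝ) (ht : ∀ v, t v ∈ Set.Icc (0 : ℝ) 1) :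
    ∫ ω, ∏ v, t v ^ N v ω ∂P = Real.exp (lam * logPgf hT α r t) := by
  obtain ⟨φ, hφ, hL, hI⟩ := h.exists_measurable hT
  rw [← (h.comp hφ).integral_prod_pow_of_measurable hlam hT hL hI t ht]
  exact integral_congr_ae (hφ.mono fun ω hω => by simp [hω])

/-- The joint probability generating function of the field, computed from any root. -/
theorem IsMPMRF.integral_prod_pow [Fintype V] [MeasurableSpace Ω] {P : Measure Ω} {lam : ℝ}
    (hlam : 0 ≤ lam) {α : Sym2 V → unitInterval} {N : V → Ω → ℕ} (hT : T.IsTree)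
    (h : IsMPMRF P lam α T N) (r : V) (t : V → ℝ) (ht : ∀ v, t v ∈ Set.Icc (0 : ℝ) 1) :
    ∫ ω, ∏ v, t v ^ N v ω ∂P = Real.exp (lam * logPgf hT α r t) := by
  obtain ⟨r', Ω', _, P', L, I, N', _, hD, hid⟩ := h
  rw [logPgf_eq hT α r r', ← hD.integral_prod_pow hlam hT t ht]
  have hm : Measurable fun x : V → ℕ => ∏ v, t v ^ x v := measurable_of_countable _
  exact (hid.comp hm).integral_eq

end JointPgf

/-! ### The law of a component and the total -/

section ComponentAndTotal

open Polynomial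

/-- The coefficients of a generating function with nonnegative coefficients are the point
probabilities. -/
theorem HasPgf.integral_eq_pairing {Ω : Type*} [MeasurableSpace Ω] {P : Measure Ω}
    [IsProbabilityMeasure P] {H : Ω → ℕ} {φ : ℝ → ℝ} (hH : HasPgf P H φ) {p : ℝ[X]}
    (hp : CoeffNonneg p) (hφ : ∀ t, φ t = p.eval t) (f : ℕ → ℝ) :
    ∫ ω, f (H ω) ∂P = pairing f p := by
  let ν : Measure ℕ := ∑ k ∈ p.support, ENNReal.ofReal (p.coeff k) • Measure.dirac k
  have hν : ∀ g : ℕ → ℝ, ∫ k, g k ∂ν = pairing g p := by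
    intro g
    rw [pairing_eq_sum, integral_finsetSum_measure]
    · simp [ENNReal.toReal_ofReal (hp _)]
    · exact fun k _ => (integrable_dirac (by simp)).smul_measure ENNReal.ofReal_ne_top
  have hνfin : IsFiniteMeasure ν := by
    constructor
    simp only [ν, Measure.finsetSum_apply, Measure.smul_apply, measure_univ, smul_eq_mul, mul_one]
    exact ENNReal.sum_lt_top.2 fun k _ => ENNReal.ofReal_lt_top
  have hHm := hH.1
  have hconst : Measurable fun (n : ℕ) (_ : Unit) => n := measurable_of_countable _
  have hprob : IsProbabilityMeasure (P.map H) := Measure.isProbabilityMeasure_map hHm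
  have hmap : (P.map H).map (fun n _ => n) = ν.map (fun n (_ : Unit) => n) := by
    refine measure_ext_of_pgf fun u hu => ?_
    have hm : AEStronglyMeasurable (fun x : Unit → ℕ => ∏ i, u i ^ x i)
      ((P.map H).map (fun n _ => n)) := (measurable_of_countable _).aestronglyMeasurable
    have hm' : AEStronglyMeasurable (fun x : Unit → ℕ => ∏ i, u i ^ x i)
      (ν.map (fun n _ => n)) := (measurable_of_countable _).aestronglyMeasurable
    rw [integral_map hconst.aemeasurable hm, integral_map hconst.aemeasurable hm',
      integral_map hHm (measurable_of_countable _).aestronglyMeasurable]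
    simp only [Finset.univ_unique, Finset.prod_singleton]
    rw [hν, hH.2 _ ⟨by linarith [(hu default).1], (hu default).2⟩, hφ, pairing_pow]
  have heq : P.map H = ν := by
    have h := congrArg (fun μ => μ.map fun x : Unit → ℕ => x ()) hmap
    simp only at h
    rwa [Measure.map_map (measurable_of_countable _) hconst,
      Measure.map_map (measurable_of_countable _) hconst,
      show ((fun x : Unit → ℕ => x ()) ∘ fun (n : ℕ) (_ : Unit) => n) = id from rfl,
      Measure.map_id, Measure.map_id] at h
  rw [← hν, ← heq, integral_map hHm (measurable_of_countable _).aestronglyMeasurable]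

theorem integral_ite_lt_eq {Ω : Type*} [MeasurableSpace Ω] {P : Measure Ω} {H : Ω → ℕ}
    (hH : AEMeasurable H P) (j : ℕ) :
    ∫ ω, (if j < H ω then (1 : ℝ) else 0) ∂P = P.real {ω | (j : ℝ) < H ω} := by
  have h1 := integral_map (μ := P) hH (f := fun n : ℕ => if j < n then (1 : ℝ) else 0)
    (measurable_of_countable _).aestronglyMeasurable
  rw [← h1, show (fun n : ℕ => if j < n then (1 : ℝ) else 0) =
    (Set.Ioi j).indicator 1 from by ext n; simp [Set.indicator],
    integral_indicator_one (Set.to_countable _).measurableSet,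
    map_measureReal_apply_of_aemeasurable hH (Set.to_countable _).measurableSet]
  congr 1
  ext ω
  simp

/-- The stochastic order of two counts, in terms of their generating functions. -/
theorem StochasticLE.stLE {Ω Ω' : Type*} [MeasurableSpace Ω] [MeasurableSpace Ω']
    {P : Measure Ω} [IsProbabilityMeasure P] {P' : Measure Ω'} [IsProbabilityMeasure P']
    {H : Ω → ℕ} {H' : Ω' → ℕ} {φ φ' : ℝ → ℝ} (hH : HasPgf P H φ) (hH' : HasPgf P' H' φ')
    {p q : ℝ[X]} (hp : CoeffNonneg p) (hq : CoeffNonneg q) (hφ : ∀ t, φ t = p.eval t)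
    (hφ' : ∀ t, φ' t = q.eval t)
    (hst : StochasticLE P (fun ω => (H ω : ℝ)) P' (fun ω => (H' ω : ℝ))) : StLE p q := by
  refine StLE.of_tails ?_ fun j => ?_
  · have h1 := hH.integral_eq_pairing hp hφ fun _ => 1 ^ 0
    have h2 := hH'.integral_eq_pairing hq hφ' fun _ => 1 ^ 0
    have h3 := pairing_pow 1 p
    have h4 := pairing_pow 1 q
    simp only [one_pow, integral_const, probReal_univ, smul_eq_mul, mul_one] at h1 h2 h3 h4
    rw [← h3, ← h4, ← h1, ← h2]
  · rw [← hH.integral_eq_pairing hp hφ, ← hH'.integral_eq_pairing hq hφ',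
      integral_ite_lt_eq hH.1, integral_ite_lt_eq hH'.1]
    exact ENNReal.toReal_mono (measure_ne_top _ _) (hst j)

variable {V : Type*} [Fintype V] {T : SimpleGraph V}

/-- Rooting the tree at `v`, the field is a Poisson family of clusters of which those containing `v`
have the intensity `λ p`, where `p` is the generating function attached to `v`, and the other ones
the intensity `λ ρ`. -/
theorem exists_polynomial_logPgf (hT : T.IsTree) (α : Sym2 V → unitInterval) (v : V) :
    ∃ p ρ : ℝ[X], CoeffNonneg p ∧ CoeffNonneg ρ ∧
      (∀ t, eta T hT α v (fun _ => t) v = p.eval t) ∧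
      ∀ t, logPgf hT α v (fun _ => t) = (p + ρ).eval t - (p + ρ).eval 1 := by
  classical
  choose p hp hpt using exists_polynomial_eta hT α v
  let ρ : ℝ[X] := ∑ e : V × V, if e.2 ∈ ch T v e.1 then
    C (1 - (α s(e.1, e.2) : ℝ)) * p e.2 else 0
  have hρ : ∀ t, logPgf hT α v (fun _ => t) = (p v + ρ).eval t -
      (1 + ∑ e : V × V, if e.2 ∈ ch T v e.1 then 1 - (α s(e.1, e.2) : ℝ) else 0) := by
    intro t
    simp only [logPgf, eval_add, ρ, eval_finsetSum, apply_ite (eval t), eval_mul, eval_C,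
      eval_zero, hpt]
    rw [add_sub_add_comm, ← Finset.sum_sub_distrib]
    congr 1
    refine Finset.sum_congr rfl fun e _ => ?_
    split_ifs <;> ring
  refine ⟨p v, ρ, hp v, CoeffNonneg.sum _ fun e _ => ?_, hpt v, fun t => ?_⟩
  · split_ifs
    · exact (CoeffNonneg.C (sub_nonneg.2 (α _).2.2)).mul (hp _)
    · exact fun k => by simp
  · have h1 := hρ 1
    rw [logPgf_one] at h1
    rw [hρ t]
    linarith

/-- The generating function of `(N_v, M)`. -/
theorem IsMPMRF.integral_pow_mul_pow {Ω : Type*} [MeasurableSpace Ω] {P : Measure Ω} {lam : ℝ}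
    (hlam : 0 ≤ lam) {α : Sym2 V → unitInterval} {N : V → Ω → ℕ} (hT : T.IsTree)
    (h : IsMPMRF P lam α T N) (v : V) {s t : ℝ} (hs : s ∈ Set.Icc (0 : ℝ) 1)
    (ht : t ∈ Set.Icc (0 : ℝ) 1) :
    ∫ ω, s ^ N v ω * t ^ ∑ u, N u ω ∂P = Real.exp (lam *
      ((s - 1) * eta T hT α v (fun _ => t) v + logPgf hT α v (fun _ => t))) := by
  classical
  rw [← logPgf_mul_root, ← h.integral_prod_pow hlam hT]
  · refine integral_congr_ae (Filter.Eventually.of_forall fun ω => ?_)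
    simp only
    rw [← Finset.mul_prod_erase _ _ (Finset.mem_univ v), Function.update_self, mul_pow,
      ← Finset.prod_pow_eq_pow_sum, ← Finset.mul_prod_erase _ _ (Finset.mem_univ v), mul_assoc]
    congr 2
    exact Finset.prod_congr rfl fun u hu => by
      rw [Function.update_of_ne (Finset.ne_of_mem_erase hu)]
  · intro u
    by_cases hu : u = v
    · subst hu
      rw [Function.update_self]
      exact ⟨mul_nonneg hs.1 ht.1, mul_le_one₀ hs.2 ht.1 ht.2⟩
    · rw [Function.update_of_ne hu]
      exact ht

end ComponentAndTotal

theorem mainTheorem1 {V : Type*} [Fintype V] (T : SimpleGraph V) (hT : T.IsTree)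
    (lam : ℝ) (hlam : 0 < lam)
    (α : Sym2 V → unitInterval) (hα : ∀ e ∈ T.edgeSet, 0 < α e ∧ α e < 1)
    {Ω : Type*} [MeasurableSpace Ω] (P : Measure Ω) [IsProbabilityMeasure P]
    (N : V → Ω → ℕ) (hN : IsMPMRF P lam α T N)
    (M : Ω → ℕ) (hM : M = fun ω => ∑ u, N u ω)
    (v w : V)
    {Ωv : Type*} [MeasurableSpace Ωv] (Pv : Measure Ωv) [IsProbabilityMeasure Pv] (Hv : Ωv → ℕ)
    (hHv : HasPgf Pv Hv (fun t => eta T hT α v (fun _ => t) v))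
    {Ωw : Type*} [MeasurableSpace Ωw] (Pw : Measure Ωw) [IsProbabilityMeasure Pw] (Hw : Ωw → ℕ)
    (hHw : HasPgf Pw Hw (fun t => eta T hT α w (fun _ => t) w))
    (hst : StochasticLE Pv (fun ω => (Hv ω : ℝ)) Pw (fun ω => (Hw ω : ℝ))) :
    SupermodularLE P (fun ω => ![(N v ω : ℝ), (M ω : ℝ)])
      P (fun ω => ![(N w ω : ℝ), (M ω : ℝ)]) := by
  subst hM
  intro ζ hζ hiv hiw
  obtain ⟨p, ρ, hp, hρ, hpt, hΛ⟩ := exists_polynomial_logPgf hT α v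
  obtain ⟨q, ρ', hq, hρ', hqt, hΛ'⟩ := exists_polynomial_logPgf hT α w
  have hpq := hst.stLE hHv hHw hp hq hpt hqt
  have hmeas : ∀ u, AEMeasurable (fun ω => ![N u ω, ∑ x, N x ω]) P := by
    obtain ⟨_, _, _, _, _, _, _, _, _, hid⟩ := hN
    have hNm : ∀ u, AEMeasurable (N u) P :=
      fun u => (measurable_pi_apply u).comp_aemeasurable hid.aemeasurable_fst
    exact fun u => aemeasurable_pi_iff.2 fun i => by
      fin_cases i
      · exact hNm u
      · exact Finset.aemeasurable_fun_sum _ fun x _ => hNm x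
  have hζm : ∀ μ : Measure (Fin 2 → ℕ), AEStronglyMeasurable
      (fun x : Fin 2 → ℕ => ζ ![(x 0 : ℝ), (x 1 : ℝ)]) μ := fun μ =>
    (measurable_of_countable _).aestronglyMeasurable
  have hpgf : ∀ u, ∀ s ∈ Set.Icc (0 : ℝ) 1, ∀ t ∈ Set.Icc (0 : ℝ) 1,
      ∫ x, s ^ x 0 * t ^ x 1 ∂(P.map fun ω => ![N u ω, ∑ x, N x ω]) = Real.exp (lam *
      ((s - 1) * eta T hT α u (fun _ => t) u + logPgf hT α u (fun _ => t))) := by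
    intro u s hs t ht
    rw [integral_map (hmeas u) (measurable_of_countable _).aestronglyMeasurable]
    exact hN.integral_pow_mul_pow hlam.le hT u hs ht
  -- The generating functions of the intensity of all clusters computed from `v` and from `w` agree
  -- up to a constant, which only concerns the clusters of size `0` and can be added freely.
  obtain ⟨κ, hκ⟩ : ∃ κ : ℝ, p + ρ = q + ρ' + Polynomial.C κ := by
    refine ⟨(p + ρ).eval 1 - (q + ρ').eval 1, Polynomial.funext fun t => ?_⟩
    have h := logPgf_eq hT α v w fun _ => t
    rw [hΛ, hΛ'] at h
    rw [Polynomial.eval_add (p := q + ρ'), Polynomial.eval_C]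
    linarith
  have hl := CoeffNonneg.C hlam.le
  let Λ : Polynomial ℝ := Polynomial.C lam * (p + ρ + Polynomial.C |κ|)
  have hΛw : Λ = Polynomial.C lam * (q + (ρ' + Polynomial.C (κ + |κ|))) := by
    simp only [Λ, hκ, map_add]
    ring
  have hle : ∀ {p' σ : Polynomial ℝ}, CoeffNonneg σ → Λ = Polynomial.C lam * (p' + σ) →
      ∀ k, (Polynomial.C lam * p').coeff k ≤ Λ.coeff k := by
    intro p' σ hσ h k
    rw [h, Polynomial.coeff_C_mul, Polynomial.coeff_C_mul, Polynomial.coeff_add]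
    exact mul_le_mul_of_nonneg_left (le_add_of_nonneg_right (hσ k)) hlam.le
  have key := integral_le_of_marking (hl.mul hp) (hl.mul hq)
    (hle (hρ.add (CoeffNonneg.C (abs_nonneg κ))) (by simp only [Λ, add_assoc]))
    (hle (hρ'.add (CoeffNonneg.C (by linarith [neg_abs_le κ]))) hΛw)
    (hpq.mul_left hl) (μ := P.map fun ω => ![N v ω, ∑ x, N x ω])
    (ν := P.map fun ω => ![N w ω, ∑ x, N x ω]) ?_ ?_ hζ
    ((integrable_map_measure (hζm _) (hmeas v)).2 hiv)
    ((integrable_map_measure (hζm _) (hmeas w)).2 hiw)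
  · rwa [integral_map (hmeas v) (hζm _), integral_map (hmeas w) (hζm _)] at key
  · intro s hs t ht
    rw [hpgf v s hs t ht, hpt, hΛ]
    simp only [Λ, Polynomial.eval_mul, Polynomial.eval_add, Polynomial.eval_C]
    ring_nf
  · intro s hs t ht
    rw [hpgf w s hs t ht, hqt, hΛ', hΛw]
    simp only [Polynomial.eval_mul, Polynomial.eval_add, Polynomial.eval_C]
    ring_nf
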